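/- All graphs are finite, simple and undirected; $\log$ is the logarithm to base $2$, and $0\log 0=0$. For a graph $G$ with at least one edge, with vertex degrees $d(v)$, the degree-based entropy is $$I_d(G)=-\sum_{v}\frac{d(v)}{\sum_u d(u)}\log\frac{d(v)}{\sum_u d(u)} .$$ For $1\le t\le k$ let $K(k,t)$ be the graph obtained from the clique $K_k$ by adding one new vertex joined to exactly $t$ vertices of $K_k$, and let $K(k,0)=K_k$ (no vertex is added). Put $\sigma(0)=0$ and $\sigma(x)=1$ for $x\ne0$. Let $G$ be a graph with $n\ge 2$ vertices and $m$ edges, $1\le m\le\binom n2$. Set $k^*=\max\{k\in\mathbb{N}:\binom k2\le m\}$ and $t^*=m-\binom{k^*}2$. Then $$I_d(G)\ \ge\ \log(2m)-\frac{t^*k^*\log k^*+(k^*-t^*)(k^*-1)\log(k^*-1)+t^*\log t^*}{2m},$$ and equality holds if and only if $G$ is isomorphic to the disjoint union of $K(k^*,t^*)$ and $n-k^*-\sigma(t^*)$ isolated vertices. Moreover, $G$ maximizes $\sum_v d(v)\log d(v)$ among all graphs with $n$ vertices and $m$ edges if and only if $G$ is isomorphic to this same graph. -/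

import Mathlib

open SimpleGraph

namespace DegreeEntropy

/-- The degree-based entropy `I_d(G) = -∑ v, (d(v) / ∑ u, d(u)) * log₂ (d(v) / ∑ u, d(u))`.
Isolated vertices contribute `0`, which is the convention `0 log 0 = 0`. -/
noncomputable def degreeEntropy {V : Type*} [Fintype V] (G : SimpleGraph V)
    [DecidableRel G.Adj] : ℝ :=
  -∑ v, ((G.degree v : ℝ) / ∑ u, (G.degree u : ℝ)) *
    Real.logb 2 ((G.degree v : ℝ) / ∑ u, (G.degree u : ℝ))

/-- `h_d(G) = ∑ v, d(v) log₂ d(v)`, with `0 log 0 = 0`. -/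
noncomputable def degreeLogSum {V : Type*} [Fintype V] (G : SimpleGraph V)
    [DecidableRel G.Adj] : ℝ :=
  ∑ v, (G.degree v : ℝ) * Real.logb 2 (G.degree v : ℝ)

/-- `k* = max {k : C(k, 2) ≤ m}`. -/
noncomputable def kStar (m : ℕ) : ℕ := sSup {k : ℕ | k.choose 2 ≤ m}

/-- The supremum defining `k*` is a maximum. -/
theorem kStar_isGreatest (m : ℕ) : IsGreatest {k : ℕ | k.choose 2 ≤ m} (kStar m) := by
  have hb : BddAbove {k : ℕ | k.choose 2 ≤ m} := by
    refine ⟨m + 1, fun k hk => ?_⟩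
    by_contra! h
    have h1 : (m + 2).choose 2 ≤ k.choose 2 := Nat.choose_le_choose 2 h
    have h2 : (m + 2).choose 2 = (m + 1).choose 1 + (m + 1).choose 2 :=
      Nat.choose_succ_succ (m + 1) 1
    rw [Nat.choose_one_right] at h2
    have h3 : k.choose 2 ≤ m := hk
    omega
  exact ⟨Nat.sSup_mem ⟨0, by simp⟩ hb, fun k hk => le_csSup hb hk⟩

/-- `t* = m - C(k*, 2)`; the subtraction never truncates, by `kStar_isGreatest`. -/
noncomputable def tStar (m : ℕ) : ℕ := m - (kStar m).choose 2

/-- `σ(0) = 0` and `σ(x) = 1` otherwise. -/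
def sigma (x : ℕ) : ℕ := if x = 0 then 0 else 1

/-- The quasi-complete graph `K(k, t)`: the clique on `Fin k` together with, when `t ≠ 0`, one
further vertex joined to the `t` clique vertices `0, …, t - 1` (meant for `t ≤ k`).
In particular `K(k, 0)` is `K_k`, with no further vertex. -/
def quasiComplete (k t : ℕ) : SimpleGraph (Fin k ⊕ Fin (sigma t)) where
  Adj
    | Sum.inl i, Sum.inl j => i ≠ j
    | Sum.inl i, Sum.inr _ => (i : ℕ) < t
    | Sum.inr _, Sum.inl j => (j : ℕ) < t
    | Sum.inr _, Sum.inr _ => False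
  symm := ⟨by rintro (i | i) (j | j) h <;> first | exact h | exact Ne.symm h⟩
  loopless := ⟨by rintro (i | i) h <;> first | exact h rfl | exact h⟩

/-- The disjoint union of `K(k*, t*)` and `n - k* - σ(t*)` isolated vertices. For `1 ≤ m ≤ C(n, 2)`
the subtractions do not truncate, so this graph has `n` vertices. -/
noncomputable def extremalGraph (n m : ℕ) :
    SimpleGraph ((Fin (kStar m) ⊕ Fin (sigma (tStar m))) ⊕
      Fin (n - kStar m - sigma (tStar m))) :=
  quasiComplete (kStar m) (tStar m) ⊕g
    (⊥ : SimpleGraph (Fin (n - kStar m - sigma (tStar m))))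

end DegreeEntropy

/-! The probabilities sum to 1, so the entropy equals `log (2m)` minus `∑ d log d / (2m)`, and both
claims reduce to finding the maximizers of `∑ f(d)`, where `f x = x log x`. The argument is a strong
induction on the number of edges, written `C(k,2) + t` with `t < k`.

Let `G` be a maximizer. By strict convexity of `f`, moving one end of an edge to a vertex of at
least the same degree raises the sum. Neighbourhoods are therefore nested (`IsXlogMax.nested`), and
`G` is a clique `K` plus an independent set, with a dominating vertex in `K` and another clique
vertex that sees nothing outside `K` (`IsXlogMax.exists_clique`).

At most `#K` non-isolated vertices lie outside `K` (`IsXlogMax.card_sdiff_le`): otherwise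
subadditivity of entropy for the crossing edges, with a tangent bound and the slack at the two
special vertices, shows that regrouping the crossing edges into full stars is strictly better
(`split_xlogSum_lt`). Hence there are at most `k + 1` non-isolated vertices
(`IsXlogMax.card_verts_le`): with more, the edges at an outside vertex of least degree could be
reinserted profitably among the others.

With `k` non-isolated vertices the graph is complete. With `k + 1`, deleting a vertex of least
degree leaves either a complete graph, hence `K(k, t)`, or a graph controlled by the induction
hypothesis; the latter contradicts `colexValue_step`, which rests on concavity of the increments of
`f`. -/

namespace DegreeEntropy

/-! ### Calculus of `x log x` and its increments -/

/-- The function `x ↦ x log x`, with the natural logarithm. -/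
noncomputable def xlog (x : ℝ) : ℝ := x * Real.log x

/-- The increment `f (x + 1) - f x` of `f x = x log x`. -/
noncomputable def xlogStep (x : ℝ) : ℝ := xlog (x + 1) - xlog x

@[simp] theorem xlog_zero : xlog 0 = 0 := by simp [xlog]

@[simp] theorem xlog_one : xlog 1 = 0 := by simp [xlog]

theorem strictConvexOn_xlog : StrictConvexOn ℝ (Set.Ici 0) xlog := Real.strictConvexOn_mul_log

theorem continuous_xlog : Continuous xlog := Real.continuous_mul_log

theorem hasDerivAt_xlog {x : ℝ} (hx : x ≠ 0) : HasDerivAt xlog (Real.log x + 1) x :=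
  Real.hasDerivAt_mul_log hx

theorem hasDerivAt_xlogStep {x : ℝ} (hx : 0 < x) :
    HasDerivAt xlogStep (Real.log (x + 1) - Real.log x) x := by
  have h1 : HasDerivAt (fun y : ℝ => xlog (y + 1)) (Real.log (x + 1) + 1) x :=
    (hasDerivAt_xlog (by positivity)).comp_add_const x 1
  have h2 := h1.sub (hasDerivAt_xlog hx.ne')
  rwa [add_sub_add_right_eq_sub] at h2

theorem continuous_xlogStep : Continuous xlogStep :=
  (continuous_xlog.comp (continuous_id.add continuous_const)).sub continuous_xlog

theorem strictMonoOn_xlogStep : StrictMonoOn xlogStep (Set.Ici 0) := by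
  refine strictMonoOn_of_deriv_pos (convex_Ici 0) continuous_xlogStep.continuousOn ?_
  intro x hx
  rw [interior_Ici] at hx
  rw [(hasDerivAt_xlogStep hx).deriv]
  have := Real.log_lt_log hx (lt_add_one x)
  linarith

/-- The derivative `log ((x + 1) / x)` is strictly decreasing. -/
theorem strictConcaveOn_xlogStep : StrictConcaveOn ℝ (Set.Ici 0) xlogStep := by
  refine StrictAntiOn.strictConcaveOn_of_deriv (convex_Ici 0) continuous_xlogStep.continuousOn ?_
  rw [interior_Ici]
  intro x hx y hy hxy
  rw [(hasDerivAt_xlogStep hx).deriv, (hasDerivAt_xlogStep hy).deriv]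
  have hx0 : (0 : ℝ) < x := hx
  have hy0 : (0 : ℝ) < y := hy
  rw [← Real.log_div (by positivity) (by positivity), ← Real.log_div (by positivity) (by positivity)]
  apply Real.log_lt_log (by positivity)
  rw [div_lt_div_iff₀ hy0 hx0]
  nlinarith

theorem xlogStep_le {a b : ℕ} (h : a ≤ b) : xlogStep a ≤ xlogStep b :=
  strictMonoOn_xlogStep.monotoneOn (by simp) (by simp) (by exact_mod_cast h)

theorem xlogStep_lt {a b : ℕ} (h : a < b) : xlogStep a < xlogStep b :=
  strictMonoOn_xlogStep (by simp) (by simp) (by exact_mod_cast h)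

/-- The second differences of `xlogStep` are negative. -/
theorem xlogStep_second_diff (a : ℕ) :
    xlogStep (a + 2 : ℕ) - xlogStep (a + 1 : ℕ) < xlogStep (a + 1 : ℕ) - xlogStep a := by
  have hc := strictConcaveOn_xlogStep.2
  have h := hc (x := (a : ℝ)) (y := ((a + 2 : ℕ) : ℝ)) (by simp)
    (by simp only [Set.mem_Ici]; positivity) (by simp)
    (a := 1 / 2) (b := 1 / 2) (by norm_num) (by norm_num) (by norm_num)
  have e : (1 / 2 : ℝ) • (a : ℝ) + (1 / 2 : ℝ) • ((a + 2 : ℕ) : ℝ) = ((a + 1 : ℕ) : ℝ) := by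
    simp only [smul_eq_mul]; push_cast; ring
  rw [e] at h
  simp only [smul_eq_mul] at h
  linarith

theorem xlogStep_diff_lt {a b : ℕ} (h : a < b) :
    xlogStep (b + 1 : ℕ) - xlogStep b < xlogStep (a + 1 : ℕ) - xlogStep a := by
  have hanti : StrictAnti fun n : ℕ => xlogStep (n + 1 : ℕ) - xlogStep n :=
    strictAnti_nat_of_succ_lt fun n => xlogStep_second_diff n
  exact hanti h

theorem xlog_succ (a : ℕ) : xlog (a + 1 : ℕ) = xlog a + xlogStep a := by
  simp [xlogStep]

/-- Doubling the argument of `xlogStep` costs less than `log 2`. -/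
theorem xlogStep_two_mul (a : ℕ) : xlogStep (2 * a : ℕ) < xlogStep a + Real.log 2 := by
  have h2 : ∀ y : ℝ, 0 ≤ y → xlog (2 * y) = 2 * xlog y + 2 * y * Real.log 2 := by
    intro y hy
    rcases hy.eq_or_lt with rfl | hy
    · simp
    · rw [xlog, Real.log_mul (by norm_num) hy.ne', xlog]; ring
  -- These two increments add up to `f (2a + 2) - f (2a) = 2 * xlogStep a + 2 * log 2`, so the
  -- smaller one is below half of that.
  have h : xlogStep (2 * a : ℕ) < xlogStep (2 * a + 1 : ℕ) := xlogStep_lt (Nat.lt_succ_self _)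
  have e1 := xlog_succ (2 * a)
  have e2 := xlog_succ (2 * a + 1)
  have e3 := h2 a (by positivity)
  have e4 := h2 (a + 1 : ℕ) (by positivity)
  have e5 := xlog_succ a
  have e6 : ((2 * a + 1 + 1 : ℕ) : ℝ) = 2 * (a + 1 : ℕ) := by push_cast; ring
  have e7 : ((2 * a : ℕ) : ℝ) = 2 * a := by push_cast; ring
  rw [e6] at e2
  rw [e7] at e1 h ⊢
  have e8 : ((a + 1 : ℕ) : ℝ) = a + 1 := by push_cast; ring
  rw [e8] at e4 e5 e2
  nlinarith

/-- After division by `d` this is `(d + 1) log (1 + 1/d) ≥ 1`. The surplus `d` on the left later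
pays for `log 2 < 1` on each of `d` moved edges. -/
theorem xlog_add_self_le {d : ℕ} (hd : 1 ≤ d) : xlog d + d ≤ d * xlogStep d := by
  have h0 : (0 : ℝ) < d := by exact_mod_cast hd
  have h := Real.one_sub_inv_le_log_of_pos (x := (d + 1) / d) (by positivity)
  rw [Real.log_div (by positivity) (by positivity), inv_div] at h
  have h1 : 1 ≤ ((d : ℝ) + 1) * (Real.log (d + 1) - Real.log d) := by
    calc (1 : ℝ) = ((d : ℝ) + 1) * (1 - d / (d + 1)) := by field_simp; ring
      _ ≤ _ := by gcongr
  unfold xlogStep xlog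
  nlinarith

/-- `f (a + i) - f a` is a sum of increments. -/
theorem xlog_add_eq_sum (a s : ℕ) :
    xlog (a + s : ℕ) = xlog a + ∑ i ∈ Finset.range s, xlogStep (a + i : ℕ) := by
  induction s with
  | zero => simp
  | succ s ih => rw [Finset.sum_range_succ, ← add_assoc, xlog_succ, ih]; push_cast; ring

/-! ### Numerical inequalities for the graph comparisons -/

/-- The value `∑ v, d(v) log d(v)` of the quasi-complete graph `K(k, t)`. -/
noncomputable def colexValue (k t : ℕ) : ℝ :=
  t * xlog k + ((k : ℝ) - t) * xlog ((k : ℝ) - 1) + xlog t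

/-- Comparison of the values for `C(k, 2) + t` and `C(k, 2) - s` edges. -/
theorem colexValue_step {k s t : ℕ} (hs : 1 ≤ s) (hk : t + s + 2 ≤ k) :
    colexValue (k - 1) (k - 1 - s) + xlog (t + s : ℕ) + (t + s : ℕ) * xlogStep (k - 1 : ℕ) <
      colexValue k t := by
  obtain ⟨r, rfl⟩ := Nat.exists_eq_add_of_le hk
  have e1 : t + s + 2 + r - 1 - s = t + 1 + r := by omega
  have e2 : t + s + 2 + r - 1 = t + s + 1 + r := by omega
  rw [e1, e2]
  -- With every `f` expanded into increments, the claim becomes exactly this inequality. It holds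
  -- term by term: by concavity, the unit step of `xlogStep` at `t + r + i` exceeds the one at `t +
  -- s + r`.
  have hsum : ∑ i ∈ Finset.range s, (xlogStep (t + i : ℕ) + (xlogStep (t + s + 1 + r : ℕ) -
      xlogStep (t + s + r : ℕ))) < ∑ i ∈ Finset.range s, xlogStep (t + 1 + r + i : ℕ) := by
    apply Finset.sum_lt_sum_of_nonempty (by simpa using by omega)
    intro i hi
    have hi' := Finset.mem_range.1 hi
    have h1 : xlogStep (t + i : ℕ) ≤ xlogStep (t + r + i : ℕ) := xlogStep_le (by omega)
    have h2 := xlogStep_diff_lt (a := t + r + i) (b := t + s + r) (by omega)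
    rw [show t + r + i + 1 = t + 1 + r + i by ring,
      show t + s + r + 1 = t + s + 1 + r by ring] at h2
    linarith
  rw [Finset.sum_add_distrib, Finset.sum_const, Finset.card_range, nsmul_eq_mul] at hsum
  have h1 := xlog_add_eq_sum t s
  have h2 := xlog_add_eq_sum (t + 1 + r) s
  have h3 := xlog_succ (t + s + 1 + r)
  have h4 := xlog_succ (t + s + r)
  rw [show t + 1 + r + s = t + s + 1 + r by ring] at h2
  rw [show t + s + r + 1 = t + s + 1 + r by ring] at h4
  unfold colexValue
  have c1 : ((t + s + 2 + r : ℕ) : ℝ) - 1 = (t + s + 1 + r : ℕ) := by push_cast; ring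
  have c2 : ((t + s + 1 + r : ℕ) : ℝ) - 1 = (t + s + r : ℕ) := by push_cast; ring
  rw [c1, c2]
  rw [show t + s + 1 + r + 1 = t + s + 2 + r by ring] at h3
  rw [h3]
  have c3 : ((t + s + 1 + r : ℕ) : ℝ) - (t + 1 + r : ℕ) = s := by push_cast; ring
  have c4 : ((t + s + 2 + r : ℕ) : ℝ) - t = s + 2 + r := by push_cast; ring
  have c5 : ((t + 1 + r : ℕ) : ℝ) = t + 1 + r := by push_cast; ring
  have c6 : ((t + s : ℕ) : ℝ) = t + s := by push_cast; ring
  rw [c3, c4]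
  rw [h1]
  rw [show ((t + 1 + r : ℕ) : ℝ) * xlog (t + s + 1 + r : ℕ)
    = (t + 1 + r) * xlog (t + s + 1 + r : ℕ) by rw [c5]]
  rw [show ((t + s : ℕ) : ℝ) * xlogStep (t + s + 1 + r : ℕ)
    = (t + s) * xlogStep (t + s + 1 + r : ℕ) by rw [c6]]
  have h4' : (s : ℝ) * xlog (t + s + 1 + r : ℕ)
      = s * (xlog (t + s + r : ℕ) + xlogStep (t + s + r : ℕ)) := by rw [h4]
  nlinarith

/-- The tangent bound for the concave function `c ↦ f (a + c) - f c`. -/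
theorem xlog_add_sub_le {a c x : ℝ} (ha : 0 < a) (hc : 0 ≤ c) (hx : 0 < x) :
    xlog (a + c) - xlog c ≤ (a + c) * Real.log (a + x) - c * Real.log x := by
  rcases hc.eq_or_lt with rfl | hc
  · have := Real.log_le_log ha (show a ≤ a + x by linarith)
    simp only [add_zero, xlog, zero_mul, sub_zero]
    gcongr
  have hlog := strictConcaveOn_log_Ioi.concaveOn.2
  -- The weights are chosen so that the mean of `x / c` and `1` is `(a + x) / (a + c)`.
  have hl := hlog (x := x / c) (y := 1) (by simp; positivity)
    (by simp) (a := c / (a + c)) (b := a / (a + c)) (by positivity) (by positivity)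
    (by field_simp; ring)
  have e : (c / (a + c)) • (x / c) + (a / (a + c)) • (1 : ℝ) = (a + x) / (a + c) := by
    simp only [smul_eq_mul]; field_simp; ring
  rw [e] at hl
  simp only [smul_eq_mul, Real.log_one, mul_zero, add_zero] at hl
  rw [Real.log_div (by positivity) (by positivity), Real.log_div (by positivity) (by positivity),
    div_mul_eq_mul_div, div_le_iff₀ (by positivity)] at hl
  unfold xlog
  nlinarith

/-- The sum of the defects of the tangent bound at `c = 0` and at `c = y` is smallest
at `x = y / 2`. -/
theorem defect_sum_ge {a x y : ℝ} (ha : 0 < a) (hx : 0 < x) (hy : 0 < y) :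
    xlog (2 * a + y) - xlog (a + y) - a * Real.log (4 * a) ≤
      (a * Real.log (a + x) - xlog a) +
        ((a + y) * Real.log (a + x) - y * Real.log x - (xlog (a + y) - xlog y)) := by
  -- Doubling `a` and `x` in the tangent bound merges the two defects; the factors 2 produce the `4
  -- * a`.
  have h := xlog_add_sub_le (a := 2 * a) (c := y) (x := 2 * x) (by positivity) hy.le (by positivity)
  rw [show 2 * a + 2 * x = 2 * (a + x) by ring, Real.log_mul two_ne_zero (by positivity),
    Real.log_mul two_ne_zero hx.ne'] at h
  rw [Real.log_mul (by norm_num) ha.ne', show (4 : ℝ) = 2 ^ 2 by norm_num, Real.log_pow]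
  have e : xlog a = a * Real.log a := rfl
  rw [e]
  push_cast
  nlinarith

/-- Increments of `f` over a fixed length grow. -/
theorem xlog_shift_le {a y z : ℝ} (ha : 0 ≤ a) (hy : 0 ≤ y) (hyz : y ≤ z) :
    xlog (a + y) - xlog y ≤ xlog (a + z) - xlog z := by
  rcases hyz.eq_or_lt with rfl | h
  · rfl
  rcases ha.eq_or_lt with rfl | ha
  · simp
  have hc := strictConvexOn_xlog.convexOn.2 hy
    (show a + z ∈ Set.Ici 0 by simp only [Set.mem_Ici]; linarith)
  have w : 0 < a + z - y := by linarith
  have h1 := hc (a := (z - y) / (a + z - y)) (b := a / (a + z - y))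
    (div_nonneg (by linarith) w.le) (by positivity) (by field_simp; ring)
  have h2 := hc (a := a / (a + z - y)) (b := (z - y) / (a + z - y))
    (by positivity) (div_nonneg (by linarith) w.le) (by field_simp; ring)
  simp only [smul_eq_mul] at h1 h2
  rw [show (z - y) / (a + z - y) * y + a / (a + z - y) * (a + z) = a + y by field_simp; ring] at h1
  rw [show a / (a + z - y) * y + (z - y) / (a + z - y) * (a + z) = z by field_simp; ring] at h2
  have e : (z - y) / (a + z - y) = 1 - a / (a + z - y) := by field_simp; ring
  rw [e] at h1 h2
  nlinarith

/-- The right side increases with `y`, so a smaller value suffices: `a + 2` for `a = 1, 2`, and `a`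
for `a ≥ 3`. There it equals `a (3 log 3 - 4 log 2) > a / 2`, and `a / 2 ≥ 3 (a + 1) / 8` holds
precisely from `a = 3` on. -/
theorem defect_bound {a y : ℕ} (ha : 1 ≤ a) (hy : a + 2 ≤ y) :
    3 * ((a : ℝ) + 1) / 8 < xlog (2 * a + y) - xlog (a + y) - a * Real.log (4 * a) := by
  have key : ∀ z : ℝ, 0 ≤ z → z ≤ y →
      xlog (2 * a + z) - xlog (a + z) ≤ xlog (2 * a + y) - xlog (a + y) := by
    intro z hz hzy
    have h := xlog_shift_le (a := a) (y := a + z) (z := a + y) (by positivity) (by positivity)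
      (by linarith)
    rwa [← add_assoc, ← add_assoc, ← two_mul] at h
  have hyR : (a : ℝ) + 2 ≤ y := by exact_mod_cast hy
  have l8 : Real.log 8 = 3 * Real.log 2 := by
    rw [show (8 : ℝ) = 2 ^ 3 by norm_num, Real.log_pow]; norm_num
  have l4 : Real.log 4 = 2 * Real.log 2 := by
    rw [show (4 : ℝ) = 2 ^ 2 by norm_num, Real.log_pow]; norm_num
  have l6 : Real.log 6 = Real.log 2 + Real.log 3 := by
    rw [show (6 : ℝ) = 2 * 3 by norm_num, Real.log_mul (by norm_num) (by norm_num)]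
  rcases (by omega : a = 1 ∨ a = 2 ∨ 3 ≤ a) with rfl | rfl | h3
  · have h := key 3 (by norm_num) (by norm_num at hyR ⊢; linarith)
    have h5 := Real.one_sub_inv_le_log_of_pos (x := 5 / 4) (by norm_num)
    rw [Real.log_div (by norm_num) (by norm_num), l4] at h5
    norm_num [xlog, l4] at h h5 ⊢
    linarith
  · have h := key 4 (by norm_num) (by norm_num at hyR ⊢; linarith)
    have h5 := Real.one_sub_inv_le_log_of_pos (x := 4 / 3) (by norm_num)
    rw [Real.log_div (by norm_num) (by norm_num), l4] at h5
    norm_num [xlog, l4, l6, l8] at h h5 ⊢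
    linarith
  · have h := key a (by positivity) (by linarith)
    have h0 : (0 : ℝ) < a := by positivity
    have h3R : (3 : ℝ) ≤ a := by exact_mod_cast h3
    have h27 : (1 : ℝ) < 2 * (3 * Real.log 3 - 4 * Real.log 2) := by
      have : 2 * (3 * Real.log 3 - 4 * Real.log 2) = Real.log (729 / 256) := by
        rw [Real.log_div (by norm_num) (by norm_num), show (729 : ℝ) = 3 ^ 6 by norm_num,
          show (256 : ℝ) = 2 ^ 8 by norm_num, Real.log_pow, Real.log_pow]
        push_cast; ring
      rw [this, Real.lt_log_iff_exp_lt (by norm_num)]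
      have := Real.exp_one_lt_d9
      norm_num at this ⊢
      linarith
    rw [show 2 * (a : ℝ) + a = 3 * a by ring, ← two_mul, xlog, xlog,
      Real.log_mul (by norm_num) h0.ne', Real.log_mul (by norm_num) h0.ne'] at h
    rw [Real.log_mul (by norm_num) h0.ne', l4]
    nlinarith

/-- The maximum of `r log (j / r)` is `j / e`, and `e > 8/3`. This is what an incomplete star can
lose, to be outweighed by `defect_bound`. -/
theorem mul_log_div_le {j r : ℝ} (hj : 0 < j) (hr : 0 ≤ r) :
    r * Real.log j - xlog r ≤ 3 * j / 8 := by
  rcases hr.eq_or_lt with rfl | hr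
  · simp; positivity
  have h1 := Real.log_le_sub_one_of_pos (x := 3 * j / (8 * r)) (by positivity)
  have h8 : Real.log 8 - Real.log 3 ≤ 1 := by
    rw [← Real.log_div (by norm_num) (by norm_num), Real.log_le_iff_le_exp (by norm_num)]
    have := Real.exp_one_gt_d9
    norm_num at this ⊢
    linarith
  rw [Real.log_div (by positivity) (by positivity), Real.log_mul (by norm_num) hj.ne',
    Real.log_mul (by norm_num) hr.ne'] at h1
  have h2 : Real.log j - Real.log r ≤ 3 * j / (8 * r) := by linarith
  have h3 := mul_le_mul_of_nonneg_left h2 hr.le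
  have e : r * (3 * j / (8 * r)) = 3 * j / 8 := by field_simp
  rw [e] at h3
  unfold xlog
  linarith

/-- Convexity at the mean of `j` numbers, `r` of which are `a + 1` and the others `a`. -/
theorem xlog_mean_le {a j r : ℕ} (hj : 1 ≤ j) (hr : r ≤ j) :
    j * xlog (a + r / j) ≤ r * xlog (a + 1) + ((j : ℝ) - r) * xlog a := by
  have hj0 : (0 : ℝ) < j := by exact_mod_cast hj
  have hrR : (r : ℝ) ≤ j := by exact_mod_cast hr
  have hc := strictConvexOn_xlog.convexOn.2
  have h := hc (x := (a + 1 : ℝ)) (y := a)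
    (by simp only [Set.mem_Ici]; positivity) (by simp)
    (a := r / j) (b := (j - r) / j) (by positivity) (div_nonneg (by linarith) hj0.le)
    (by field_simp; ring)
  simp only [smul_eq_mul] at h
  rw [show (r : ℝ) / j * (a + 1) + (j - r) / j * a = a + r / j by field_simp; ring] at h
  calc j * xlog (a + r / j) ≤ j * (r / j * xlog (a + 1) + (j - r) / j * xlog a) := by gcongr
    _ = _ := by field_simp

/-! ### Degree sums of graphs -/

section Graph

open Classical Finset

variable {V : Type*} [Fintype V]

/-- The degree of a vertex, as the cardinality of a filter. -/
noncomputable def deg (G : SimpleGraph V) (v : V) : ℕ := #{u | G.Adj v u}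

/-- The sum of the degrees, i.e. twice the number of edges. -/
noncomputable def degSum (G : SimpleGraph V) : ℕ := ∑ v, deg G v

/-- `∑ v, d(v) log d(v)` with the natural logarithm. -/
noncomputable def xlogSum (G : SimpleGraph V) : ℝ := ∑ v, xlog (deg G v)

/-- `G` maximizes `xlogSum` among the graphs on its vertex set with the same number of edges. -/
def IsXlogMax (G : SimpleGraph V) : Prop :=
  ∀ H : SimpleGraph V, degSum H = degSum G → xlogSum H ≤ xlogSum G

/-- The non-isolated vertices. -/
noncomputable def verts (G : SimpleGraph V) : Finset V := {v | deg G v ≠ 0}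

theorem deg_eq_card {G : SimpleGraph V} {v : V} {s : Finset V} (h : ∀ u, u ∈ s ↔ G.Adj v u) :
    deg G v = #s :=
  congrArg card (by ext u; simp [h])

theorem mem_verts_of_adj {G : SimpleGraph V} {a b : V} (h : G.Adj a b) : a ∈ verts G := by
  simp only [verts, mem_filter, mem_univ, true_and, deg, ne_eq, card_eq_zero]
  exact ne_empty_of_mem (a := b) (by simpa using h)

theorem deg_ne_zero_iff {G : SimpleGraph V} {a : V} : deg G a ≠ 0 ↔ ∃ b, G.Adj a b := by
  simp [deg, filter_eq_empty_iff]

theorem deg_add_one_le_card {G : SimpleGraph V} {S : Finset V} (hS : ∀ a b, G.Adj a b → a ∈ S)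
    {v : V} (hv : v ∈ S) : deg G v + 1 ≤ #S := by
  rw [← card_erase_add_one hv]
  gcongr
  refine card_le_card fun u hu => ?_
  have hu' : G.Adj v u := by simpa using hu
  exact mem_erase.2 ⟨hu'.ne', hS _ _ hu'.symm⟩

theorem card_le_deg_add_one {G : SimpleGraph V} {Q : Finset V} {v : V}
    (h : ∀ u ∈ Q, u ≠ v → G.Adj v u) : #Q ≤ deg G v + 1 := by
  have : #(Q.erase v) ≤ deg G v := by
    refine card_le_card fun u hu => ?_
    have := mem_erase.1 hu
    simpa using h u this.2 this.1
  have h2 := Finset.pred_card_le_card_erase (s := Q) (a := v)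
  omega

theorem degSum_eq_sum {G : SimpleGraph V} {S : Finset V} (hS : ∀ a b, G.Adj a b → a ∈ S) :
    degSum G = ∑ v ∈ S, deg G v := by
  refine (sum_subset (subset_univ S) fun v _ hv => ?_).symm
  by_contra h
  obtain ⟨b, hb⟩ := deg_ne_zero_iff.1 h
  exact hv (hS _ _ hb)

theorem degSum_add_card_le {G : SimpleGraph V} {S : Finset V} (hS : ∀ a b, G.Adj a b → a ∈ S) :
    degSum G + #S ≤ #S * #S := by
  rw [degSum_eq_sum hS, card_eq_sum_ones, ← sum_add_distrib, ← card_eq_sum_ones]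
  calc ∑ v ∈ S, (deg G v + 1) ≤ ∑ v ∈ S, #S := sum_le_sum fun v hv => deg_add_one_le_card hS hv
    _ = _ := by simp

theorem degSum_add_card_of_complete {G : SimpleGraph V} {S : Finset V}
    (hS : ∀ a b, G.Adj a b → a ∈ S) (hc : ∀ a ∈ S, ∀ b ∈ S, a ≠ b → G.Adj a b) :
    degSum G + #S = #S * #S := by
  refine le_antisymm (degSum_add_card_le hS) ?_
  rw [degSum_eq_sum hS]
  calc #S * #S = ∑ v ∈ S, #S := by simp
    _ ≤ ∑ v ∈ S, (deg G v + 1) := sum_le_sum fun v hv => card_le_deg_add_one fun u hu huv => hc v hv u hu huv.symm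
    _ = _ := by simp [sum_add_distrib]

/-- Equality in `degSum_add_card_le` forces equality at each vertex of `S`. -/
theorem complete_of_degSum {G : SimpleGraph V} {S : Finset V} (hS : ∀ a b, G.Adj a b → a ∈ S)
    (h : #S * #S ≤ degSum G + #S) : ∀ a ∈ S, ∀ b ∈ S, a ≠ b → G.Adj a b := by
  have h1 : ∀ v ∈ S, deg G v + 1 = #S := by
    have hle : ∀ v ∈ S, deg G v + 1 ≤ #S := fun v hv => deg_add_one_le_card hS hv
    rw [← sum_eq_sum_iff_of_le hle]
    have := degSum_add_card_le hS
    rw [sum_add_distrib, ← degSum_eq_sum hS]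
    simp only [sum_const, smul_eq_mul, mul_one]
    omega
  intro a ha b hb hab
  have hsub : ({u | G.Adj a u} : Finset V) ⊆ S.erase a := fun u hu => by
    have hu' : G.Adj a u := by simpa using hu
    exact mem_erase.2 ⟨hu'.ne', hS _ _ hu'.symm⟩
  have heq := eq_of_subset_of_card_le hsub (by
    have := h1 a ha
    rw [card_erase_of_mem ha]
    unfold deg at this
    omega)
  have : b ∈ ({u | G.Adj a u} : Finset V) := heq ▸ mem_erase.2 ⟨hab.symm, hb⟩
  simpa using this

/-! ### Adding an edge -/

theorem deg_sup_edge {H : SimpleGraph V} {a b : V} (hab : a ≠ b) (h : ¬ H.Adj a b) (v : V) :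
    deg (H ⊔ edge a b) v = deg H v + if v = a ∨ v = b then 1 else 0 := by
  by_cases hva : v = a
  · subst hva
    rw [deg_eq_card (s := insert b ({u | H.Adj v u} : Finset V)), card_insert_of_notMem (by simpa using h)]
    · simp [deg]
    · intro u
      simp only [mem_filter, mem_univ, true_and, sup_adj, edge_adj, mem_insert]
      grind
  · by_cases hvb : v = b
    · subst hvb
      rw [deg_eq_card (s := insert a ({u | H.Adj v u} : Finset V)),
        card_insert_of_notMem (by simpa [H.adj_comm] using h)]
      · simp [deg]
      · intro u
        simp only [mem_filter, mem_univ, true_and, sup_adj, edge_adj, mem_insert]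
        grind
    · rw [if_neg (by simp [hva, hvb]), add_zero]
      exact deg_eq_card fun u => by simp [edge_adj, hva, hvb]

theorem degSum_sup_edge {H : SimpleGraph V} {a b : V} (hab : a ≠ b) (h : ¬ H.Adj a b) :
    degSum (H ⊔ edge a b) = degSum H + 2 := by
  unfold degSum
  simp only [deg_sup_edge hab h, sum_add_distrib]
  have : ({x | x = a ∨ x = b} : Finset V) = {a, b} := by ext; simp
  rw [sum_boole, this, card_pair hab]
  rfl

theorem xlogSum_sup_edge {H : SimpleGraph V} {a b : V} (hab : a ≠ b) (h : ¬ H.Adj a b) :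
    xlogSum (H ⊔ edge a b) = xlogSum H + xlogStep (deg H a) + xlogStep (deg H b) := by
  unfold xlogSum
  have : ∀ v, xlog (deg (H ⊔ edge a b) v : ℕ) = xlog (deg H v) +
      ((if v = a then xlogStep (deg H a) else 0) + if v = b then xlogStep (deg H b) else 0) := by
    intro v
    rw [deg_sup_edge hab h]
    by_cases hva : v = a
    · subst hva; simp [hab, ← xlog_succ]
    · by_cases hvb : v = b
      · subst hvb; simp [hva, ← xlog_succ]
      · simp [hva, hvb]
  simp only [this, sum_add_distrib, sum_ite_eq', mem_univ, if_true]
  ring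

/-! ### Nested neighbourhoods of a maximizer -/

/-- Otherwise replace the edge `uw` by `vw`. Once `uw` is gone, `u` has smaller degree than `v`, so
the increment gained at `v` exceeds the one lost at `u`; the contributions at `w` cancel. -/
theorem IsXlogMax.nested {G : SimpleGraph V} (hG : IsXlogMax G) {u v w : V}
    (hd : deg G u ≤ deg G v) (huw : G.Adj u w) (hwv : w ≠ v) : G.Adj v w := by
  by_contra hvw
  have huv : u ≠ v := fun h => hvw (h ▸ huw)
  set H := G \ edge u w with hH
  have hHuw : ¬ H.Adj u w := by simp [hH, edge_adj, huw.ne]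
  have hGH : H ⊔ edge u w = G := by
    rw [hH, sdiff_sup_self, sup_eq_left]
    exact (edge_le_iff _).2 (Or.inr huw)
  have hHvw : ¬ H.Adj v w := fun h => hvw (by rw [hH] at h; exact h.1)
  have e1 := degSum_sup_edge huw.ne hHuw
  have e2 := degSum_sup_edge hwv.symm hHvw
  have x1 := xlogSum_sup_edge huw.ne hHuw
  have x2 := xlogSum_sup_edge hwv.symm hHvw
  have d1 := deg_sup_edge huw.ne hHuw u
  have d2 := deg_sup_edge huw.ne hHuw v
  rw [hGH] at e1 x1 d1 d2
  simp only [true_or, if_true] at d1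
  rw [if_neg (by simp [huv.symm, hwv.symm])] at d2
  have hm := hG (H ⊔ edge v w) (by omega)
  have hlt : xlogStep (deg H u) < xlogStep (deg H v) := xlogStep_lt (by omega)
  linarith

theorem IsXlogMax.adj_of_max_deg {G : SimpleGraph V} (hG : IsXlogMax G) {u w : V}
    (hu : ∀ x, deg G x ≤ deg G u) (hw : w ∈ verts G) (hwu : w ≠ u) : G.Adj u w := by
  obtain ⟨x, hx⟩ := deg_ne_zero_iff.1 (by simpa [verts] using hw)
  exact hG.nested (hu x) hx.symm hwu

/-- A maximizer is a split graph with a dominating vertex and with a clique vertex that has no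
neighbour outside the clique. -/
theorem IsXlogMax.exists_clique {G : SimpleGraph V} (hG : IsXlogMax G) (h0 : degSum G ≠ 0) :
    ∃ K : Finset V, 2 ≤ #K ∧ K ⊆ verts G ∧ (∀ a ∈ K, ∀ b ∈ K, a ≠ b → G.Adj a b) ∧
      (∀ a ∉ K, ∀ b ∉ K, ¬ G.Adj a b) ∧ (∀ a ∉ K, ∃ y ∈ K, ¬ G.Adj a y) ∧
      (∃ y ∈ K, ∀ a ∉ K, ¬ G.Adj y a) ∧ ∃ u ∈ K, ∀ w ∈ verts G, w ≠ u → G.Adj u w := by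
  let P : Finset V → Prop := fun Q => ∀ a ∈ Q, ∀ b ∈ Q, a ≠ b → G.Adj a b
  obtain ⟨K₀, hK₀, hmax₀⟩ := exists_max_image (univ.filter P) card ⟨∅, by simp [P]⟩
  -- Among the maximum cliques, one of largest degree sum: swapping a clique vertex for an outside
  -- non-neighbour of larger degree would improve it, which gives `hdeg`.
  obtain ⟨K, hK, hmax⟩ := exists_max_image (univ.filter fun Q => P Q ∧ #Q = #K₀)
    (fun Q => ∑ v ∈ Q, deg G v) ⟨K₀, by simpa using hK₀⟩
  simp only [mem_filter, mem_univ, true_and] at hK hmax hmax₀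
  have hcl : P K := hK.1
  have hcard : ∀ Q, P Q → #Q ≤ #K := fun Q hQ => hK.2 ▸ hmax₀ Q hQ
  have hins : ∀ (Q : Finset V) (a : V), P Q → (∀ y ∈ Q, a ≠ y → G.Adj a y) → P (insert a Q) := by
    intro Q a hQ ha x hx y hy hxy
    rcases mem_insert.1 hx with rfl | hx' <;> rcases mem_insert.1 hy with rfl | hy'
    · exact absurd rfl hxy
    · exact ha y hy' hxy
    · exact (ha x hx' hxy.symm).symm
    · exact hQ x hx' y hy' hxy
  have hnon : ∀ a ∉ K, ∃ y ∈ K, ¬ G.Adj a y := by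
    intro a ha
    by_contra! h
    have := hcard _ (hins K a hcl fun y hy _ => h y hy)
    rw [card_insert_of_notMem ha] at this
    omega
  have hdeg : ∀ a ∉ K, ∀ y ∈ K, ¬ G.Adj a y → deg G a ≤ deg G y := by
    intro a ha y hy hay
    by_contra! hlt
    have hPe : P (K.erase y) := fun x hx z hz => hcl x (mem_of_mem_erase hx) z (mem_of_mem_erase hz)
    have hP : P (insert a (K.erase y)) := hins _ a hPe fun z hz haz =>
      hG.nested hlt.le (hcl y hy z (mem_of_mem_erase hz) (ne_of_mem_erase hz).symm) haz.symm
    have ha' : a ∉ K.erase y := fun h => ha (mem_of_mem_erase h)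
    have h1 := hmax _ ⟨hP, by
      rw [card_insert_of_notMem ha', card_erase_add_one hy, hK.2]⟩
    rw [sum_insert ha', ← add_sum_erase K _ hy] at h1
    omega
  have hind : ∀ a ∉ K, ∀ b ∉ K, ¬ G.Adj a b := by
    intro a ha b hb hab
    obtain ⟨y, hy, hay⟩ := hnon a ha
    obtain ⟨z, hz, hbz⟩ := hnon b hb
    have hyb : G.Adj y b := hG.nested (hdeg a ha y hy hay) hab fun h => hb (h ▸ hy)
    have hza : G.Adj z a := hG.nested (hdeg b hb z hz hbz) hab.symm fun h => ha (h ▸ hz)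
    rcases le_total (deg G z) (deg G y) with h | h
    · exact hay (hG.nested h hza fun e => ha (e ▸ hy)).symm
    · exact hbz (hG.nested h hyb fun e => hb (e ▸ hz)).symm
  have h2 : 2 ≤ #K := by
    obtain ⟨a, -, ha⟩ := exists_ne_zero_of_sum_ne_zero h0
    obtain ⟨b, hb⟩ := deg_ne_zero_iff.1 ha
    rw [← card_pair hb.ne]
    exact hcard _ (hins _ a (by simp [P]) fun y hy _ => by simp_all)
  have hsub : K ⊆ verts G := by
    intro a ha
    obtain ⟨b, hb, hba⟩ := exists_mem_ne (by omega : 1 < #K) a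
    exact mem_verts_of_adj (hcl a ha b hb hba.symm)
  refine ⟨K, h2, hsub, hcl, hind, hnon, ?_, ?_⟩
  -- If the clique vertex of least degree saw `a` outside, nestedness would make `a` adjacent to all
  -- of `K`.
  · obtain ⟨y, hy, hymin⟩ := exists_min_image K (deg G) (card_pos.1 (by omega))
    refine ⟨y, hy, fun a ha hya => ?_⟩
    obtain ⟨z, hz, haz⟩ := hnon a ha
    exact haz (hG.nested (hymin z hz) hya fun h => ha (h ▸ hz)).symm
  · have : (univ : Finset V).Nonempty := ⟨_, mem_univ (card_pos.1 (by omega : 0 < #K)).choose⟩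
    obtain ⟨u, -, hu⟩ := exists_max_image univ (deg G) this
    have hadj : ∀ w ∈ verts G, w ≠ u → G.Adj u w := fun w hw hwu =>
      hG.adj_of_max_deg (fun x => hu x (mem_univ x)) hw hwu
    refine ⟨u, ?_, hadj⟩
    by_contra huK
    obtain ⟨y, hy, huy⟩ := hnon u huK
    exact huy (hadj y (hsub hy) fun h => huK (h ▸ hy))

/-! ### Removing a vertex, and adding edges -/

/-- `G` with all edges at `v` removed. -/
def isolate (G : SimpleGraph V) (v : V) : SimpleGraph V where
  Adj a b := G.Adj a b ∧ a ≠ v ∧ b ≠ v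
  symm := ⟨fun _ _ h => ⟨h.1.symm, h.2.2, h.2.1⟩⟩
  loopless := ⟨fun _ h => h.1.ne rfl⟩

theorem deg_isolate_self (G : SimpleGraph V) (v : V) : deg (isolate G v) v = 0 := by
  simp [deg, isolate]

theorem deg_isolate {G : SimpleGraph V} {u v : V} (huv : u ≠ v) :
    deg G u = deg (isolate G v) u + if G.Adj v u then 1 else 0 := by
  rw [deg_eq_card (G := isolate G v) (s := ({w | G.Adj u w} : Finset V).erase v)]
  · split_ifs with h
    · rw [card_erase_add_one (by simpa using h.symm)]; rfl
    · rw [erase_eq_of_notMem (by simpa [G.adj_comm] using h), add_zero]; rfl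
  · intro w
    simp only [isolate, mem_filter, mem_univ, true_and, mem_erase]
    tauto

theorem degSum_isolate (G : SimpleGraph V) (v : V) :
    degSum G = degSum (isolate G v) + 2 * deg G v := by
  have h : ∀ u, deg G u = deg (isolate G v) u +
      ((if G.Adj v u then 1 else 0) + if u = v then deg G v else 0) := by
    intro u
    by_cases huv : u = v
    · subst huv; simp [deg_isolate_self]
    · rw [deg_isolate huv]; simp [huv]
  unfold degSum
  rw [sum_congr rfl fun u _ => h u, sum_add_distrib, sum_add_distrib, sum_boole, sum_ite_eq']
  simp only [mem_univ, if_true, Nat.cast_id]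
  rw [two_mul]
  rfl

/-- A neighbour of `v` has at most `M` other neighbours, so it loses at most `xlogStep M`. -/
theorem xlogSum_le_isolate {G : SimpleGraph V} {v : V} {M : ℕ} (hM : ∀ u, deg G u ≤ M + 1) :
    xlogSum G ≤ xlogSum (isolate G v) + xlog (deg G v) + deg G v * xlogStep M := by
  have h : ∀ u, xlog (deg G u) ≤ xlog (deg (isolate G v) u) +
      ((if G.Adj v u then xlogStep M else 0) + if u = v then xlog (deg G v) else 0) := by
    intro u
    by_cases huv : u = v
    · subst huv; simp [deg_isolate_self]
    · have h1 := deg_isolate huv (G := G)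
      rw [if_neg huv, add_zero]
      split_ifs with hadj
      · rw [if_pos hadj] at h1
        rw [h1, xlog_succ]
        gcongr
        exact xlogStep_le (by have := hM u; omega)
      · rw [if_neg hadj] at h1
        rw [h1]; simp
  unfold xlogSum
  calc ∑ u, xlog (deg G u) ≤ _ := sum_le_sum fun u _ => h u
    _ = _ := by
      rw [sum_add_distrib, sum_add_distrib, sum_ite_eq', ← sum_filter, sum_const, nsmul_eq_mul]
      simp only [mem_univ, if_true]
      unfold deg
      ring

/-- A non-complete graph on `S` with all degrees at least `d` and with a clique of size `j + 1`
can be extended by edges each of which raises `xlogSum` by at least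
`xlogStep d + xlogStep j`. -/
theorem exists_extension {S Q : Finset V} {d j : ℕ} (hQS : Q ⊆ S) (hQ : j + 1 ≤ #Q) (e : ℕ) :
    ∀ H : SimpleGraph V, (∀ a b, H.Adj a b → a ∈ S) → (∀ a ∈ Q, ∀ b ∈ Q, a ≠ b → H.Adj a b) →
      (∀ x ∈ S, d ≤ deg H x) → degSum H + 2 * e + #S ≤ #S * #S →
      ∃ H' : SimpleGraph V, degSum H' = degSum H + 2 * e ∧
        xlogSum H + e * (xlogStep d + xlogStep j) ≤ xlogSum H' := by
  induction e with
  | zero => exact fun H _ _ _ _ => ⟨H, by simp, by simp⟩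
  | succ e ih =>
    intro H hS hcl hd he
    -- A largest clique `R` in `S` supplies the next edge: a vertex of `S` outside `R` misses some
    -- `y ∈ R`, and `y` already has degree at least `j`.
    obtain ⟨R, hR, hmax⟩ := exists_max_image
      (S.powerset.filter fun R => ∀ a ∈ R, ∀ b ∈ R, a ≠ b → H.Adj a b) card
      ⟨Q, by simpa using ⟨hQS, hcl⟩⟩
    simp only [mem_filter, mem_powerset] at hR hmax
    have hjR : j + 1 ≤ #R := hQ.trans (hmax Q ⟨hQS, hcl⟩)
    obtain ⟨x, hxS, hxR⟩ : ∃ x ∈ S, x ∉ R := by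
      by_contra! h
      have hRS : R = S := Subset.antisymm hR.1 h
      have := degSum_add_card_of_complete hS (hRS ▸ hR.2)
      omega
    obtain ⟨y, hyR, hxy⟩ : ∃ y ∈ R, ¬ H.Adj x y := by
      by_contra! h
      have h1 := hmax (insert x R) ⟨insert_subset hxS hR.1, by
        intro a ha b hb hab
        rcases mem_insert.1 ha with rfl | ha' <;> rcases mem_insert.1 hb with rfl | hb'
        · exact absurd rfl hab
        · exact h b hb'
        · exact (h a ha').symm
        · exact hR.2 a ha' b hb' hab⟩
      rw [card_insert_of_notMem hxR] at h1
      omega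
    have hne : x ≠ y := fun h => hxR (h ▸ hyR)
    have hdy : j ≤ deg H y := by
      have := card_le_deg_add_one fun u hu huy => hR.2 y hyR u hu (Ne.symm huy)
      omega
    have e1 := degSum_sup_edge hne hxy
    have e2 := xlogSum_sup_edge hne hxy
    obtain ⟨H', h1, h2⟩ := ih (H ⊔ edge x y)
      (by
        intro a b hab
        rcases hab with hab | hab
        · exact hS a b hab
        · rw [edge_adj] at hab
          rcases hab.1 with h | h
          · exact h.1 ▸ hxS
          · exact h.1 ▸ hR.1 hyR)
      (fun a ha b hb hab => Or.inl (hcl a ha b hb hab))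
      (fun z hz => by rw [deg_sup_edge hne hxy]; exact (hd z hz).trans (Nat.le_add_right _ _))
      (by omega)
    refine ⟨H', by omega, ?_⟩
    have h3 : xlogStep d ≤ xlogStep (deg H x) := xlogStep_le (hd x hxS)
    have h4 : xlogStep j ≤ xlogStep (deg H y) := xlogStep_le hdy
    push_cast
    linarith

/-! ### Layered graphs -/

/-- The clique on `K`, with the vertices of `I` joined to all of `K` and those of `W` joined
to all of `T`. -/
def layered (K I T W : Finset V) : SimpleGraph V where
  Adj a b := a ≠ b ∧ (a ∈ K ∧ b ∈ K ∨ a ∈ K ∧ b ∈ I ∨ a ∈ I ∧ b ∈ K ∨ a ∈ T ∧ b ∈ W ∨ a ∈ W ∧ b ∈ T)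
  symm := ⟨fun _ _ h => ⟨h.1.symm, by tauto⟩⟩
  loopless := ⟨fun _ h => h.1 rfl⟩

/-- A general `φ` serves both the edge count and `xlogSum`. For empty `T` the set `W` is
unrestricted, since its vertices are then isolated and `φ 0 = 0`. -/
theorem sum_layered {M : Type*} [AddCommMonoid M] {K I T W : Finset V} (hT : T ⊆ K)
    (hKI : Disjoint K I) (hKW : Disjoint K W) (hIW : Disjoint I W) (hW : T.Nonempty → #W = 1)
    (φ : ℕ → M) (hφ : φ 0 = 0) :
    ∑ v, φ (deg (layered K I T W) v) =
      #T • φ (#K + #I) + (#K - #T) • φ (#K + #I - 1) + #I • φ #K + φ #T := by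
  have hKI' : ∀ v, v ∈ K → v ∉ I := fun v hv => Finset.disjoint_left.1 hKI hv
  have hKW' : ∀ v, v ∈ K → v ∉ W := fun v hv => Finset.disjoint_left.1 hKW hv
  have hIW' : ∀ v, v ∈ I → v ∉ W := fun v hv => Finset.disjoint_left.1 hIW hv
  have dT : ∀ v ∈ T, deg (layered K I T W) v = #K + #I := by
    intro v hv
    have h1 := hW ⟨v, hv⟩
    rw [deg_eq_card (s := (K.erase v).disjUnion I (hKI.mono_left (erase_subset _ _)) ∪ W),
      card_union_of_disjoint, card_disjUnion, h1]
    · have := card_erase_add_one (hT hv); omega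
    · rw [disjUnion_eq_union, disjoint_union_left]
      exact ⟨hKW.mono_left (erase_subset _ _), hIW⟩
    · intro u
      have := hT hv
      have := hKI' v
      have := hKW' v
      simp only [layered, mem_union, mem_disjUnion, mem_erase]
      grind
  have dK : ∀ v ∈ K \ T, deg (layered K I T W) v = #K + #I - 1 := by
    intro v hv
    rw [mem_sdiff] at hv
    rw [deg_eq_card (s := (K.erase v).disjUnion I (hKI.mono_left (erase_subset _ _))),
      card_disjUnion]
    · have := card_erase_add_one hv.1; omega
    · intro u
      have := hKI' v
      have := hKW' v
      simp only [layered, mem_disjUnion, mem_erase]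
      grind
  have dI : ∀ v ∈ I, deg (layered K I T W) v = #K := by
    intro v hv
    refine deg_eq_card fun u => ?_
    have := hKI' v
    have := hIW' v
    have := @hT v
    simp only [layered]
    grind
  have dW : ∀ v ∈ W, deg (layered K I T W) v = #T := by
    intro v hv
    refine deg_eq_card fun u => ?_
    have := hKW' v
    have := hIW' v
    have := @hT u
    have := @hT v
    simp only [layered]
    grind
  have d0 : ∀ v ∉ (K ∪ I) ∪ W, deg (layered K I T W) v = 0 := by
    intro v hv
    simp only [mem_union] at hv
    have := @hT v
    rw [deg_eq_card (s := ∅), card_empty]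
    intro u
    simp only [layered]
    grind
  rw [← sum_subset (subset_univ ((K ∪ I) ∪ W)) fun v _ hv => by rw [d0 v hv, hφ],
    sum_union (disjoint_union_left.2 ⟨hKW, hIW⟩), sum_union hKI, ← sum_sdiff hT,
    sum_eq_card_nsmul fun v hv => congrArg φ (dK v hv),
    sum_eq_card_nsmul fun v hv => congrArg φ (dT v hv),
    sum_eq_card_nsmul fun v hv => congrArg φ (dI v hv),
    sum_eq_card_nsmul fun v hv => congrArg φ (dW v hv), card_sdiff_of_subset hT]
  have : #W • φ #T = φ #T := by
    rcases T.eq_empty_or_nonempty with rfl | h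
    · simp [hφ]
    · rw [hW h, one_smul]
  rw [this, add_comm ((#K - #T) • φ (#K + #I - 1))]

theorem degSum_layered {K I T W : Finset V} (hT : T ⊆ K)
    (hKI : Disjoint K I) (hKW : Disjoint K W) (hIW : Disjoint I W) (hW : T.Nonempty → #W = 1) :
    degSum (layered K I T W) + #K = #K * #K + 2 * (#I * #K + #T) := by
  have h := sum_layered hT hKI hKW hIW hW (fun n => n) rfl
  have hle := card_le_card hT
  rw [degSum, h]
  simp only [smul_eq_mul]
  generalize #K = k at *
  generalize #T = t at *
  generalize #I = a at *
  obtain ⟨s, rfl⟩ := Nat.exists_eq_add_of_le hle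
  rw [Nat.add_sub_cancel_left]
  rcases s with _ | s
  · ring
  · rw [show t + (s + 1) + a - 1 = t + s + a by omega]
    ring

theorem xlogSum_layered {K I T W : Finset V} (hT : T ⊆ K)
    (hKI : Disjoint K I) (hKW : Disjoint K W) (hIW : Disjoint I W) (hW : T.Nonempty → #W = 1) :
    xlogSum (layered K I T W) = #T * xlog (#K + #I : ℕ) +
      ((#K : ℝ) - #T) * xlog (#K + #I - 1 : ℕ) + #I * xlog #K + xlog #T := by
  have h := sum_layered hT hKI hKW hIW hW (fun n => xlog (n : ℝ)) (by simp)
  rw [xlogSum, h]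
  simp only [nsmul_eq_mul, Nat.cast_sub (card_le_card hT)]

/-- `G` is the quasi-complete graph `K(k, t)` together with isolated vertices. -/
def IsColex (G : SimpleGraph V) (k t : ℕ) : Prop :=
  ∃ K T W : Finset V, T ⊆ K ∧ Disjoint K W ∧ #K = k ∧ #T = t ∧ #W = sigma t ∧
    G = layered K ∅ T W

theorem card_eq_one_of_sigma {V : Type*} {T W : Finset V} (h : #W = sigma #T) (hT : T.Nonempty) : #W = 1 := by
  rw [h, sigma, if_neg hT.card_pos.ne']

theorem IsColex.degSum {G : SimpleGraph V} {k t : ℕ} (h : IsColex G k t) :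
    degSum G + k = k * k + 2 * t := by
  obtain ⟨K, T, W, hT, hKW, rfl, rfl, hW, rfl⟩ := h
  simpa using degSum_layered hT (disjoint_empty_right K) hKW (disjoint_empty_left W)
    (card_eq_one_of_sigma hW)

theorem IsColex.xlogSum {G : SimpleGraph V} {k t : ℕ} (h : IsColex G k t) (hk : 1 ≤ k) :
    xlogSum G = colexValue k t := by
  obtain ⟨K, T, W, hT, hKW, rfl, rfl, hW, rfl⟩ := h
  rw [xlogSum_layered hT (disjoint_empty_right K) hKW (disjoint_empty_left W)
    (card_eq_one_of_sigma hW), colexValue]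
  simp [Nat.cast_sub hk]

theorem exists_isColex {k t : ℕ} (htk : t ≤ k) (h : k + sigma t ≤ Fintype.card V) :
    ∃ G : SimpleGraph V, IsColex G k t := by
  obtain ⟨K, -, hK⟩ := exists_subset_card_eq (s := (univ : Finset V)) (n := k)
    (by rw [card_univ]; omega)
  obtain ⟨T, hTK, hT⟩ := exists_subset_card_eq (s := K) (n := t) (by omega)
  obtain ⟨W, hWK, hW⟩ := exists_subset_card_eq (s := Kᶜ) (n := sigma t)
    (by rw [card_compl]; omega)
  exact ⟨_, K, T, W, hTK, disjoint_compl_right.mono_right hWK, hK, hT, hW, rfl⟩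

/-! ### The entropy bound for split graphs -/

/-- Subadditivity of entropy for the uniform distribution on the edges of a bipartite graph. -/
theorem sum_xlog_bipartite_le {α β : Type*} (r : α → β → Prop) (s : Finset α) (t : Finset β) :
    ∑ u ∈ s, xlog #(t.bipartiteAbove r u) + ∑ v ∈ t, xlog #(s.bipartiteBelow r v) ≤
      xlog (∑ u ∈ s, #(t.bipartiteAbove r u) : ℕ) := by
  have hqb := sum_card_bipartiteAbove_eq_sum_card_bipartiteBelow (s := s) (t := t) r
  obtain ⟨c, hc⟩ : ∃ c : α → ℕ, ∀ u, #(t.bipartiteAbove r u) = c u := ⟨_, fun _ => rfl⟩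
  obtain ⟨b, hb⟩ : ∃ b : β → ℕ, ∀ v, #(s.bipartiteBelow r v) = b v := ⟨_, fun _ => rfl⟩
  simp only [hc, hb] at hqb ⊢
  obtain ⟨q, hq⟩ : ∃ q, q = ∑ u ∈ s, c u := ⟨_, rfl⟩
  rw [← hq] at hqb ⊢
  have habove : ∀ (u : α) (x : ℝ), ∑ v ∈ t, (if r u v then x else 0) = c u * x := by
    intro u x
    rw [← sum_filter, sum_const, nsmul_eq_mul, ← hc, bipartiteAbove]
  have hbelow : ∀ (v : β) (x : ℝ), ∑ u ∈ s, (if r u v then x else 0) = b v * x := by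
    intro v x
    rw [← sum_filter, sum_const, nsmul_eq_mul, ← hb, bipartiteBelow]
  -- This is `log x ≤ x - 1` at `x = c u * b v / q` on each edge. Summed over all pairs, `c u * b v
  -- / q` gives `q`, the number of edges, so the corrections cancel.
  have hpt : ∀ u ∈ s, ∀ v ∈ t,
      (if r u v then Real.log (c u) else 0) + (if r u v then Real.log (b v) else 0) ≤
        (if r u v then Real.log q else 0) + (c u * b v / q - if r u v then 1 else 0) := by
    intro u hu v hv
    split_ifs with h
    · have h1 : 0 < c u := hc u ▸ card_pos.2 ⟨v, by simp [bipartiteAbove, hv, h]⟩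
      have h2 : 0 < b v := hb v ▸ card_pos.2 ⟨u, by simp [bipartiteBelow, hu, h]⟩
      have h3 : 0 < q := h1.trans_le (hq ▸ single_le_sum (fun _ _ => Nat.zero_le _) hu)
      have h1' : (0 : ℝ) < c u := by exact_mod_cast h1
      have h2' : (0 : ℝ) < b v := by exact_mod_cast h2
      have h3' : (0 : ℝ) < q := by exact_mod_cast h3
      have := Real.log_le_sub_one_of_pos (x := c u * b v / q) (by positivity)
      rw [Real.log_div (by positivity) h3'.ne', Real.log_mul h1'.ne' h2'.ne'] at this
      linarith
    · simp only [add_zero, sub_zero, zero_add]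
      positivity
  have hsum := sum_le_sum fun u hu => sum_le_sum fun v hv => hpt u hu v hv
  simp only [sum_add_distrib, sum_sub_distrib] at hsum
  rw [sum_comm (s := s) (t := t) (f := fun u v => if r u v then Real.log (b v) else 0)] at hsum
  simp only [habove, hbelow] at hsum
  have e1 : ∑ u ∈ s, ∑ v ∈ t, (c u * b v / q : ℝ) = q := by
    simp only [← sum_div, ← mul_sum, ← sum_mul]
    rw [← Nat.cast_sum, ← Nat.cast_sum, ← hqb, ← hq, mul_self_div_self]
  have e2 : ∑ u ∈ s, (c u : ℝ) = q := by rw [hq, Nat.cast_sum]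
  rw [e1, ← sum_mul, ← sum_mul, e2] at hsum
  unfold xlog
  linarith

/-- In a graph that consists of a clique `K`, an independent set and a bipartite graph in between,
with a clique vertex without outside neighbours and one with `X ≥ #K + 1` outside neighbours,
the sum is less than for the graph in which the outside edges are collected in full stars. -/
theorem split_xlogSum_lt {A X a r : ℕ} (hA : 1 ≤ A) (hX : A + 2 ≤ X) (hr : r ≤ A) {α β : Type*}
    {K : Finset α} {J : Finset β} (R : α → β → Prop) (hK : #K = A + 1)
    (hq : ∑ u ∈ K, #(J.bipartiteAbove R u) = a * (A + 1) + r) {x y : α} (hx : x ∈ K) (hy : y ∈ K)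
    (hcx : #(J.bipartiteAbove R x) = X) (hcy : #(J.bipartiteAbove R y) = 0) :
    ∑ u ∈ K, xlog (A + #(J.bipartiteAbove R u) : ℕ) + ∑ v ∈ J, xlog #(K.bipartiteBelow R v) <
      r * xlog (A + a + 1 : ℕ) + (((A + 1 : ℕ) : ℝ) - r) * xlog (A + a : ℕ) +
        a * xlog (A + 1 : ℕ) + xlog r := by
  have hent := sum_xlog_bipartite_le R K J
  obtain ⟨c, hc⟩ : ∃ c : α → ℕ, ∀ u, #(J.bipartiteAbove R u) = c u := ⟨_, fun _ => rfl⟩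
  simp only [hc] at hent hq hcx hcy ⊢
  have hxy : x ≠ y := by rintro rfl; omega
  obtain ⟨q, hqdef⟩ : ∃ q, q = ∑ u ∈ K, c u := ⟨_, rfl⟩
  rw [← hqdef] at hent hq
  have hq1 : 1 ≤ q := by
    have : c x ≤ q := hqdef ▸ single_le_sum (fun _ _ => Nat.zero_le _) hx
    omega
  have hj0 : (0 : ℝ) < (A + 1 : ℕ) := by positivity
  have hA0 : (0 : ℝ) < A := by exact_mod_cast hA
  have hX0 : (0 : ℝ) < X := by exact_mod_cast (by omega : 0 < X)
  have hq0 : (0 : ℝ) < q := by exact_mod_cast hq1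
  -- The tangent is taken at the mean outside degree `z`; at `y` and `x` the exact defects are kept.
  obtain ⟨z, hz⟩ : ∃ z : ℝ, z = q / (A + 1 : ℕ) := ⟨_, rfl⟩
  have hz0 : 0 < z := by rw [hz]; positivity
  have hzq : ((A + 1 : ℕ) : ℝ) * z = q := by rw [hz]; field_simp
  obtain ⟨tan, htan⟩ : ∃ tan : ℝ → ℝ, ∀ s, tan s = (A + s) * Real.log (A + z) - s * Real.log z :=
    ⟨_, fun _ => rfl⟩
  have hpt : ∀ u ∈ K, xlog (A + c u : ℕ) ≤ xlog (c u) + tan (c u) -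
      ((if u = y then A * Real.log (A + z) - xlog A else 0) +
        if u = x then (A + X) * Real.log (A + z) - X * Real.log z - (xlog (A + X) - xlog X)
          else 0) := by
    intro u hu
    by_cases huy : u = y
    · have : c u = 0 := huy ▸ hcy
      rw [if_pos huy, if_neg (fun h => hxy (h.symm.trans huy)), this, htan]
      simp
    · by_cases hux : u = x
      · have : c u = X := hux ▸ hcx
        rw [if_neg huy, if_pos hux, this, htan]
        push_cast
        linarith
      · rw [if_neg huy, if_neg hux]
        have := xlog_add_sub_le hA0 (Nat.cast_nonneg (c u)) hz0
        rw [htan]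
        push_cast
        linarith
  have hsum := sum_le_sum hpt
  rw [sum_sub_distrib, sum_add_distrib, sum_add_distrib, sum_ite_eq', sum_ite_eq', if_pos hx,
    if_pos hy] at hsum
  have htsum : ∑ u ∈ K, tan (c u) =
      ((A + 1 : ℕ) : ℝ) * xlog (A + z) + q * Real.log (A + 1 : ℕ) - xlog q := by
    have e : ∑ u ∈ K, ((A : ℝ) + c u) = (A + 1 : ℕ) * (A + z) := by
      rw [sum_add_distrib, sum_const, hK, nsmul_eq_mul, mul_add, hzq, hqdef, Nat.cast_sum]
    have e' : Real.log z = Real.log q - Real.log (A + 1 : ℕ) := by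
      rw [hz, Real.log_div hq0.ne' hj0.ne']
    simp only [htan, sum_sub_distrib, ← sum_mul, e]
    rw [← Nat.cast_sum, ← hqdef, e']
    unfold xlog
    ring
  have hdef := defect_sum_ge hA0 hz0 hX0
  have hdef2 := defect_bound hA hX
  have hrem := mul_log_div_le hj0 (Nat.cast_nonneg r)
  have hmean := xlog_mean_le (a := A + a) (j := A + 1) (r := r) (by omega) (by omega)
  have hqR : (q : ℝ) = a * (A + 1 : ℕ) + r := by exact_mod_cast hq
  have hAz : ((A + a : ℕ) : ℝ) + r / (A + 1 : ℕ) = A + z := by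
    rw [hz, hqR]; field_simp; push_cast; ring
  rw [hAz] at hmean
  have e4 : (a : ℝ) * xlog (A + 1 : ℕ) = (q - r) * Real.log (A + 1 : ℕ) := by
    rw [hqR, xlog]; ring
  have e5 : xlog (A + a + 1 : ℕ) = xlog ((A + a : ℕ) + 1) := by push_cast; rfl
  rw [e4, e5]
  have e6 : ((A + 1 : ℕ) : ℝ) = A + 1 := by push_cast; ring
  have e7 : 3 * ((A + 1 : ℕ) : ℝ) / 8 = 3 * ((A : ℝ) + 1) / 8 := by rw [e6]
  linarith

/-- Otherwise `split_xlogSum_lt` applies, with the dominating vertex as `x` and all outside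
non-isolated vertices as its `X` neighbours. The competitor is a layered graph with the same number
of edges. -/
theorem IsXlogMax.card_sdiff_le {G : SimpleGraph V} (hG : IsXlogMax G) {K : Finset V}
    (h2 : 2 ≤ #K) (hKv : K ⊆ verts G) (hcl : ∀ a ∈ K, ∀ b ∈ K, a ≠ b → G.Adj a b)
    (hind : ∀ a ∉ K, ∀ b ∉ K, ¬ G.Adj a b) (hy : ∃ y ∈ K, ∀ a ∉ K, ¬ G.Adj y a)
    (hu : ∃ u ∈ K, ∀ w ∈ verts G, w ≠ u → G.Adj u w) : #(verts G \ K) ≤ #K := by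
  by_contra! hlt
  obtain ⟨A, hA⟩ : ∃ A, #K = A + 1 := ⟨#K - 1, by omega⟩
  obtain ⟨y, hyK, hy⟩ := hy
  obtain ⟨u, huK, hu⟩ := hu
  set J := verts G \ K with hJ
  set c : V → ℕ := fun w => #(J.bipartiteAbove G.Adj w) with hc
  have hcy : c y = 0 := by
    rw [hc, card_eq_zero, bipartiteAbove, filter_eq_empty_iff]
    exact fun a ha => hy a (mem_sdiff.1 ha).2
  have hcu : c u = #J := by
    rw [hc]
    simp only [bipartiteAbove]
    rw [filter_true_of_mem]
    exact fun a ha => hu a (mem_sdiff.1 ha).1 fun e => (mem_sdiff.1 ha).2 (e ▸ huK)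
  have hdK : ∀ w ∈ K, deg G w = A + c w := by
    intro w hw
    have hd : Disjoint (K.erase w) (J.bipartiteAbove G.Adj w) := by
      rw [Finset.disjoint_left]
      intro a ha ha'
      rw [mem_bipartiteAbove, mem_sdiff] at ha'
      exact ha'.1.2 (mem_of_mem_erase ha)
    rw [deg_eq_card (s := (K.erase w) ∪ J.bipartiteAbove G.Adj w), card_union_of_disjoint hd,
      card_erase_of_mem hw, hA, Nat.add_sub_cancel]
    intro a
    rw [mem_union, mem_erase, mem_bipartiteAbove, hJ, mem_sdiff]
    constructor
    · rintro (h | h)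
      · exact hcl w hw a h.2 h.1.symm
      · exact h.2
    · intro h
      by_cases ha : a ∈ K
      · exact Or.inl ⟨h.ne', ha⟩
      · exact Or.inr ⟨⟨mem_verts_of_adj h.symm, ha⟩, h⟩
  have hdJ : ∀ v ∈ J, deg G v = #(K.bipartiteBelow G.Adj v) := by
    intro v hv
    refine deg_eq_card fun a => ?_
    rw [mem_bipartiteBelow]
    refine ⟨fun h => h.2.symm, fun h => ⟨?_, h.symm⟩⟩
    by_contra ha
    exact hind v (mem_sdiff.1 hv).2 a ha h
  have hsum : ∀ {M : Type} [AddCommMonoid M] (φ : ℕ → M), φ 0 = 0 → ∑ v, φ (deg G v) =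
      ∑ w ∈ K, φ (A + c w) + ∑ v ∈ J, φ #(K.bipartiteBelow G.Adj v) := by
    intro M _ φ hφ
    have h0 : ∀ v ∉ verts G, φ (deg G v) = 0 := by
      intro v hv
      have : deg G v = 0 := by simpa [verts] using hv
      rw [this, hφ]
    rw [← sum_subset (subset_univ (verts G)) fun v _ hv => h0 v hv, ← sum_sdiff hKv, add_comm]
    exact congrArg₂ _ (sum_congr rfl fun w hw => by rw [hdK w hw])
      (sum_congr rfl fun v hv => by rw [hdJ v hv])
  set q := ∑ w ∈ K, c w with hq
  have hdeg : degSum G = (A + 1) * A + 2 * q := by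
    have h1 := hsum (fun n => n) rfl
    have h2 : ∑ v ∈ J, #(K.bipartiteBelow G.Adj v) = q :=
      (sum_card_bipartiteAbove_eq_sum_card_bipartiteBelow G.Adj).symm
    rw [degSum, h1, h2, sum_add_distrib, sum_const, hA, ← hq, smul_eq_mul]
    ring
  -- Strict because `y` has no neighbour in `J`; hence a vertex of `J` is left over for the
  -- incomplete star.
  have hqlt : q < (A + 1) * #J := by
    calc q < ∑ w ∈ K, #J := sum_lt_sum (fun w _ => card_le_card (filter_subset _ _))
          ⟨y, hyK, by
            change c y < #J
            omega⟩
      _ = _ := by rw [sum_const, hA, smul_eq_mul]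
  set a := q / (A + 1) with ha
  set r := q % (A + 1) with hr
  have hqar : q = a * (A + 1) + r := by rw [ha, hr, mul_comm]; exact (Nat.div_add_mod q (A + 1)).symm
  have hrA : r ≤ A := Nat.lt_succ_iff.1 (Nat.mod_lt _ (Nat.succ_pos A))
  have haJ : a < #J := by
    rw [ha, Nat.div_lt_iff_lt_mul (Nat.succ_pos A), mul_comm]
    exact hqlt
  obtain ⟨I, hIJ, hI⟩ := exists_subset_card_eq haJ.le
  obtain ⟨w, hwJ, hwI⟩ : ∃ w ∈ J, w ∉ I := by
    by_contra! h
    have := card_le_card (show J ⊆ I from h)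
    omega
  obtain ⟨T, hTK, hT⟩ := exists_subset_card_eq (s := K) (n := r) (by omega)
  have hKJ : Disjoint K J := disjoint_sdiff
  have hKI := hKJ.mono_right hIJ
  have hKw : Disjoint K {w} := hKJ.mono_right (singleton_subset_iff.2 hwJ)
  have hIw : Disjoint I {w} := disjoint_singleton_right.2 hwI
  have hd := degSum_layered hTK hKI hKw hIw fun _ => card_singleton w
  have hx := xlogSum_layered hTK hKI hKw hIw fun _ => card_singleton w
  have hmax := hG (layered K I T {w}) (by
    rw [hA, hT, hI, ← hqar] at hd
    rw [hdeg]
    nlinarith)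
  have hlt' := split_xlogSum_lt (A := A) (X := #J) (a := a) (r := r) (by omega) (by omega) hrA
    G.Adj hA hqar huK hyK hcu hcy
  have hGx := hsum (fun n => xlog (n : ℝ)) (by simp)
  rw [hx, hT, hI, hA, xlogSum, hGx, show A + 1 + a - 1 = A + a by omega,
    show A + 1 + a = A + a + 1 by omega] at hmax
  linarith

/-! ### Maximizers are quasi-complete -/

theorem layered_complete {V : Type*} {G : SimpleGraph V} {S : Finset V} (hS : ∀ a b, G.Adj a b → a ∈ S)
    (hc : ∀ a ∈ S, ∀ b ∈ S, a ≠ b → G.Adj a b) : G = layered S ∅ ∅ ∅ := by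
  ext a b
  simp only [layered, notMem_empty, and_false, false_and, or_false]
  exact ⟨fun h => ⟨h.ne, hS a b h, hS b a h.symm⟩, fun h => hc a h.2.1 b h.2.2 h.1⟩

/-- Delete a vertex `v` of least positive degree `d`, so that `t ≤ d < k`. If `d = t` or `d = k -
1`, the rest is complete. Otherwise `d = t + s` with `s ≥ 1`, the rest has `C(k-1,2) + (k-1-s)`
edges, and `colexValue_step` makes `K(k, t)` strictly better than `G`. -/
theorem IsXlogMax.isColex_of_card_verts {G : SimpleGraph V} (hG : IsXlogMax G) {k t : ℕ}
    (htk : t < k) (hk : 2 ≤ k) (hdeg : degSum G + k = k * k + 2 * t)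
    (ih : ∀ k' t' (H : SimpleGraph V), t' < k' → degSum H + k' = k' * k' + 2 * t' →
      degSum H < degSum G → xlogSum H ≤ colexValue k' t') (hN : #(verts G) = k + 1) :
    IsColex G k t := by
  obtain ⟨v, hv, hmin⟩ := exists_min_image (verts G) (deg G) (card_pos.1 (by omega))
  set H := isolate G v with hH
  set S := (verts G).erase v with hSdef
  have hSk : #S = k := by rw [hSdef, card_erase_of_mem hv, hN, Nat.add_sub_cancel]
  have hS : ∀ a b, H.Adj a b → a ∈ S := fun a b h => mem_erase.2 ⟨h.2.1, mem_verts_of_adj h.1⟩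
  have hGS : ∀ a b, G.Adj a b → a ∈ verts G := fun a b h => mem_verts_of_adj h
  have hsum : degSum G = degSum H + 2 * deg G v := degSum_isolate G v
  have hHle := degSum_add_card_le hS
  rw [hSk] at hHle
  have hdk : deg G v + 1 ≤ k + 1 := hN ▸ deg_add_one_le_card hGS hv
  have hd0 : deg G v ≠ 0 := by simpa [verts] using hv
  have hcomplete : (∀ a ∈ S, ∀ b ∈ S, a ≠ b → H.Adj a b) → IsColex G k t := by
    intro hc
    have h1 := degSum_add_card_of_complete hS hc
    rw [hSk] at h1
    have hdt : deg G v = t := by omega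
    refine ⟨S, ({u | G.Adj v u} : Finset V), {v}, ?_, ?_, hSk, hdt, ?_, ?_⟩
    · intro u hu
      have hu' : G.Adj v u := by simpa using hu
      exact mem_erase.2 ⟨hu'.ne', mem_verts_of_adj hu'.symm⟩
    · exact disjoint_singleton_right.2 (by simp [hSdef])
    · rw [card_singleton, sigma, if_neg (by omega)]
    · ext a b
      simp only [layered, notMem_empty, and_false, false_and, false_or, mem_filter, mem_univ,
        true_and, mem_singleton]
      constructor
      · intro h
        refine ⟨h.ne, ?_⟩
        by_cases ha : a = v
        · subst ha; exact Or.inr (Or.inr ⟨rfl, h⟩)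
        · by_cases hb : b = v
          · subst hb; exact Or.inr (Or.inl ⟨h.symm, rfl⟩)
          · exact Or.inl ⟨mem_erase.2 ⟨ha, mem_verts_of_adj h⟩,
              mem_erase.2 ⟨hb, mem_verts_of_adj h.symm⟩⟩
      · rintro ⟨hab, h | h | h⟩
        · exact (hc a h.1 b h.2 hab).1
        · exact h.2 ▸ h.1.symm
        · exact h.1 ▸ h.2
  by_cases hdt : deg G v = t
  · refine hcomplete (complete_of_degSum hS ?_)
    rw [hSk]
    omega
  have hdt' : t < deg G v := by omega
  have hdlt : deg G v < k := by
    by_contra! hge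
    have h1 : ∑ u ∈ verts G, k ≤ degSum G := by
      rw [degSum_eq_sum hGS]
      exact sum_le_sum fun u hu => hge.trans (hmin u hu)
    rw [sum_const, hN, smul_eq_mul] at h1
    nlinarith
  -- Here `v` misses only one vertex of `S`. By nestedness and minimality of its degree, `v` would
  -- miss both ends of any non-adjacent pair in `S`.
  by_cases hdk1 : deg G v + 1 = k
  · apply hcomplete
    intro a ha b hb hab
    have hav := (mem_erase.1 ha).1
    have hbv := (mem_erase.1 hb).1
    by_contra hnab
    have hGab : ¬ G.Adj a b := fun h => hnab ⟨h, hav, hbv⟩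
    have hva : ¬ G.Adj v a := fun h =>
      hGab (hG.nested (hmin b (mem_of_mem_erase hb)) h hab).symm
    have hvb : ¬ G.Adj v b := fun h =>
      hGab (hG.nested (hmin a (mem_of_mem_erase ha)) h hab.symm)
    have hsub : ({u | G.Adj v u} : Finset V) ⊆ (S.erase a).erase b := by
      intro u hu
      have hu' : G.Adj v u := by simpa using hu
      refine mem_erase.2 ⟨fun e => hvb (e ▸ hu'), mem_erase.2 ⟨fun e => hva (e ▸ hu'),
        mem_erase.2 ⟨hu'.ne', mem_verts_of_adj hu'.symm⟩⟩⟩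
    have := card_le_card hsub
    rw [card_erase_of_mem (mem_erase.2 ⟨hab.symm, hb⟩), card_erase_of_mem ha, hSk] at this
    unfold deg at hdk1
    omega
  exfalso
  obtain ⟨s, hs⟩ := Nat.exists_eq_add_of_le hdt'.le
  have hstep := colexValue_step (k := k) (s := s) (t := t) (by omega) (by omega)
  rw [← hs] at hstep
  have hH' : xlogSum H ≤ colexValue (k - 1) (k - 1 - s) := by
    refine ih _ _ _ (by omega) ?_ (by omega)
    obtain ⟨l, rfl⟩ : ∃ l, k = s + 1 + l := ⟨k - 1 - s, by omega⟩
    rw [show s + 1 + l - 1 - s = l by omega, show s + 1 + l - 1 = s + l by omega]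
    nlinarith
  have hle := xlogSum_le_isolate (G := G) (v := v) (M := k - 1) fun u => by
    by_cases hu : u ∈ verts G
    · have := deg_add_one_le_card hGS hu
      omega
    · have : deg G u = 0 := by simpa [verts] using hu
      omega
  obtain ⟨C, hC⟩ := exists_isColex (V := V) (k := k) (t := t) htk.le (by
    have h1 := card_le_univ (verts G)
    have h2 : sigma t ≤ 1 := by unfold sigma; split_ifs <;> simp
    omega)
  have h1 := hG C (by have := hC.degSum; omega)
  rw [hC.xlogSum (by omega)] at h1
  linarith

/-- With `N ≥ k + 2` non-isolated vertices, isolate an outside vertex of least degree `d`; the other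
`N - 1` have room for `d` new edges. The loss is at most `f d + d * xlogStep (N - 2)` and the gain
at least `d * (xlogStep d + xlogStep (#K - 1))`. As `N ≤ 2 * #K`, the gain is larger by
`xlogStep_two_mul`, `xlog_add_self_le` and `log 2 < 1`. -/
theorem IsXlogMax.card_verts_le {G : SimpleGraph V} (hG : IsXlogMax G) {k t : ℕ}
    (htk : t < k) (hk : 2 ≤ k) (hdeg : degSum G + k = k * k + 2 * t) : #(verts G) ≤ k + 1 := by
  by_contra! hN
  have h0 : degSum G ≠ 0 := by nlinarith
  obtain ⟨K, h2, hKv, hcl, hind, hnon, hy, hu⟩ := hG.exists_clique h0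
  have hX := hG.card_sdiff_le h2 hKv hcl hind hy hu
  have hGS : ∀ a b, G.Adj a b → a ∈ verts G := fun a b h => mem_verts_of_adj h
  rw [card_sdiff_of_subset hKv] at hX
  have hne : (verts G \ K).Nonempty := by
    rw [sdiff_nonempty]
    intro hsub
    have hKe : K = verts G := Subset.antisymm hKv hsub
    have := degSum_add_card_of_complete hGS (hKe ▸ hcl)
    nlinarith
  obtain ⟨v, hv, hmin⟩ := exists_min_image _ (deg G) hne
  obtain ⟨hvG, hvK⟩ := mem_sdiff.1 hv
  have hd0 : deg G v ≠ 0 := by simpa [verts] using hvG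
  obtain ⟨y, hyK, hvy⟩ := hnon v hvK
  have hdv : deg G v ≤ #K - 1 := by
    rw [← card_erase_of_mem hyK]
    refine card_le_card fun u hu => ?_
    have hu' : G.Adj v u := by simpa using hu
    refine mem_erase.2 ⟨fun e => hvy (e ▸ hu'), ?_⟩
    by_contra huK
    exact hind v hvK u huK hu'
  set H := isolate G v with hH
  set S := (verts G).erase v with hSdef
  have hSN : #S = #(verts G) - 1 := card_erase_of_mem hvG
  have hS : ∀ a b, H.Adj a b → a ∈ S := fun a b h => mem_erase.2 ⟨h.2.1, mem_verts_of_adj h.1⟩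
  have hKS : K ⊆ S := fun a ha => mem_erase.2 ⟨fun e => hvK (e ▸ ha), hKv ha⟩
  have hclH : ∀ a ∈ K, ∀ b ∈ K, a ≠ b → H.Adj a b := fun a ha b hb hab =>
    ⟨hcl a ha b hb hab, fun e => hvK (e ▸ ha), fun e => hvK (e ▸ hb)⟩
  have hsum : degSum G = degSum H + 2 * deg G v := degSum_isolate G v
  obtain ⟨H', h1, h2'⟩ := exists_extension (d := deg G v) (j := #K - 1) hKS (by omega) (deg G v) H
    hS hclH
    (by
      intro x hx
      by_cases hxK : x ∈ K
      · have := card_le_deg_add_one fun u hu hux => hclH x hxK u hu (Ne.symm hux)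
        omega
      · have h3 := deg_isolate (G := G) (mem_erase.1 hx).1
        rw [if_neg (hind v hvK x hxK), add_zero] at h3
        rw [← h3]
        exact hmin x (mem_sdiff.2 ⟨mem_of_mem_erase hx, hxK⟩))
    (by
      obtain ⟨l, hl⟩ : ∃ l, #S = k + 1 + l := ⟨#S - (k + 1), by omega⟩
      rw [hl]
      nlinarith)
  have hle := xlogSum_le_isolate (G := G) (v := v) (M := #(verts G) - 2) fun u => by
    by_cases hu : u ∈ verts G
    · have := deg_add_one_le_card hGS hu
      omega
    · have : deg G u = 0 := by simpa [verts] using hu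
      omega
  have hmax := hG H' (by omega)
  have hs1 : xlogStep (#(verts G) - 2 : ℕ) ≤ xlogStep (2 * (#K - 1) : ℕ) :=
    xlogStep_le (by omega)
  have hs2 := xlogStep_two_mul (#K - 1)
  have hs3 := xlog_add_self_le (d := deg G v) (by omega)
  have hl2 : Real.log 2 < 1 := by have := Real.log_two_lt_d9; linarith
  have hd : (0 : ℝ) < deg G v := by exact_mod_cast Nat.pos_of_ne_zero hd0
  have : (deg G v : ℝ) * xlogStep (#(verts G) - 2 : ℕ) <
      deg G v * (xlogStep (#K - 1 : ℕ) + 1) := by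
    apply mul_lt_mul_of_pos_left _ hd
    linarith
  linarith

theorem IsXlogMax.isColex {G : SimpleGraph V} (hG : IsXlogMax G) {k t : ℕ}
    (htk : t < k) (hk : 2 ≤ k) (hdeg : degSum G + k = k * k + 2 * t)
    (ih : ∀ k' t' (H : SimpleGraph V), t' < k' → degSum H + k' = k' * k' + 2 * t' →
      degSum H < degSum G → xlogSum H ≤ colexValue k' t') : IsColex G k t := by
  have hN := hG.card_verts_le htk hk hdeg
  have hGS : ∀ a b, G.Adj a b → a ∈ verts G := fun a b h => mem_verts_of_adj h
  have hle := degSum_add_card_le hGS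
  have hkN : k ≤ #(verts G) := by
    by_contra! h
    obtain ⟨l, rfl⟩ := Nat.exists_eq_add_of_lt h
    nlinarith
  rcases (by omega : #(verts G) = k + 1 ∨ #(verts G) = k) with h | h
  · exact hG.isColex_of_card_verts htk hk hdeg ih h
  · rw [h] at hle
    have ht : t = 0 := by omega
    subst ht
    refine ⟨verts G, ∅, ∅, empty_subset _, disjoint_empty_right _, h, rfl, by simp [sigma],
      layered_complete hGS (complete_of_degSum hGS ?_)⟩
    rw [h]
    omega

theorem exists_isXlogMax (G : SimpleGraph V) :
    ∃ H : SimpleGraph V, degSum H = degSum G ∧ IsXlogMax H := by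
  obtain ⟨H, hH, hmax⟩ := exists_max_image
    (univ.filter fun H : SimpleGraph V => degSum H = degSum G) xlogSum ⟨G, by simp⟩
  simp only [mem_filter, mem_univ, true_and] at hH hmax
  exact ⟨H, hH, fun H' h => hmax H' (h.trans hH)⟩

theorem xlogSum_le_colexValue (n : ℕ) : ∀ (k t : ℕ) (G : SimpleGraph V), t < k →
    degSum G + k = k * k + 2 * t → degSum G = n → xlogSum G ≤ colexValue k t := by
  induction n using Nat.strong_induction_on with
  | _ n ih =>
    intro k t G htk hdeg hn
    rcases (by omega : k = 1 ∨ 2 ≤ k) with rfl | hk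
    · have h0 : degSum G = 0 := by omega
      have ht : t = 0 := by omega
      have : ∀ v, deg G v = 0 := by simpa [degSum] using h0
      simp [xlogSum, this, colexValue, ht]
    · obtain ⟨H, hH, hmax⟩ := exists_isXlogMax G
      have hc := hmax.isColex htk hk (by omega) fun k' t' H' h1 h2 h3 =>
        ih (degSum H') (by omega) k' t' H' h1 h2 rfl
      rw [← hc.xlogSum (by omega)]
      exact hmax G hH.symm

theorem isXlogMax_iff_isColex {G : SimpleGraph V} {k t : ℕ} (htk : t < k) (hk : 2 ≤ k)
    (hdeg : degSum G + k = k * k + 2 * t) : IsXlogMax G ↔ IsColex G k t := by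
  constructor
  · exact fun h => h.isColex htk hk hdeg fun k' t' H h1 h2 _ =>
      xlogSum_le_colexValue _ k' t' H h1 h2 rfl
  · intro h H hH
    rw [h.xlogSum (by omega)]
    exact xlogSum_le_colexValue _ k t H htk (by omega) rfl

theorem xlogSum_eq_colexValue_iff {G : SimpleGraph V} {k t : ℕ} (htk : t < k) (hk : 2 ≤ k)
    (hdeg : degSum G + k = k * k + 2 * t) : xlogSum G = colexValue k t ↔ IsColex G k t := by
  refine ⟨fun h => ?_, fun h => h.xlogSum (by omega)⟩
  rw [← isXlogMax_iff_isColex htk hk hdeg]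
  intro H hH
  rw [h]
  exact xlogSum_le_colexValue _ k t H htk (by omega) rfl

end Graph

/-! ### From the layered description to isomorphism with the extremal graph -/

section Isomorphism

open Classical Finset

theorem deg_iso {V V' : Type*} [Fintype V] [Fintype V'] {G : SimpleGraph V} {G' : SimpleGraph V'}
    (e : G ≃g G') (v : V) : deg G' (e v) = deg G v := by
  rw [deg_eq_card (s := ({u | G.Adj v u} : Finset V).map e.toEquiv.toEmbedding), card_map, deg]
  intro u
  obtain ⟨w, rfl⟩ := e.surjective u
  simp only [mem_map_equiv, mem_filter, mem_univ, true_and, e.map_adj_iff]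
  rw [show e.toEquiv.symm (e w) = w from e.toEquiv.symm_apply_apply w]

theorem xlogSum_iso {V V' : Type*} [Fintype V] [Fintype V'] {G : SimpleGraph V}
    {G' : SimpleGraph V'} (e : G ≃g G') : xlogSum G' = xlogSum G := by
  unfold xlogSum
  rw [← Equiv.sum_comp e.toEquiv]
  exact sum_congr rfl fun v _ => by rw [← deg_iso e v]; rfl

/-- Two colourings with equally large colour classes differ by a bijection. -/
theorem exists_equiv_of_card_fiber {V V' C : Type*} [Fintype V] [Fintype V'] (f : V → C)
    (f' : V' → C) (h : ∀ c, #{v | f v = c} = #{v | f' v = c}) :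
    ∃ e : V ≃ V', ∀ v, f' (e v) = f v := by
  have E : ∀ c, {v // f v = c} ≃ {v // f' v = c} := fun c =>
    Fintype.equivOfCardEq (by rw [Fintype.card_subtype, Fintype.card_subtype, h])
  exact ⟨(Equiv.sigmaFiberEquiv f).symm.trans
    ((Equiv.sigmaCongrRight E).trans (Equiv.sigmaFiberEquiv f')), fun v => (E (f v) ⟨v, rfl⟩).2⟩

/-- The colouring of the vertices by the parts `T`, `K \ T`, `W` and the rest. -/
noncomputable def partColour {V : Type*} (K T W : Finset V) (v : V) : Fin 4 :=
  if v ∈ T then 0 else if v ∈ K then 1 else if v ∈ W then 2 else 3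

theorem card_partColour {V : Type*} [Fintype V] {K T W : Finset V} (hT : T ⊆ K)
    (hKW : Disjoint K W) (c : Fin 4) : #{v | partColour K T W v = c} =
      ![#T, #K - #T, #W, Fintype.card V - (#K + #W)] c := by
  have hKW' : ∀ v, v ∈ K → v ∉ W := fun v hv => Finset.disjoint_left.1 hKW hv
  have h : ({v | partColour K T W v = c} : Finset V) = ![T, K \ T, W, (K ∪ W)ᶜ] c := by
    ext v
    have := @hT v
    have := hKW' v
    fin_cases c <;> simp [partColour] <;> grind
  rw [h]
  fin_cases c
  · rfl
  · exact card_sdiff_of_subset hT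
  · rfl
  · change #(K ∪ W)ᶜ = Fintype.card V - (#K + #W)
    rw [card_compl, card_union_of_disjoint hKW]

/-- Distinct vertices are adjacent according to their colours alone, so a colour-preserving
bijection is an isomorphism. -/
theorem layered_adj_iff {V : Type*} {K T W : Finset V} (hT : T ⊆ K) (hKW : Disjoint K W)
    (a b : V) : (layered K ∅ T W).Adj a b ↔
      a ≠ b ∧ (partColour K T W a ≤ 1 ∧ partColour K T W b ≤ 1 ∨
        partColour K T W a = 0 ∧ partColour K T W b = 2 ∨
        partColour K T W a = 2 ∧ partColour K T W b = 0) := by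
  have hKW' : ∀ v, v ∈ K → v ∉ W := fun v hv => Finset.disjoint_left.1 hKW hv
  have h0 : ∀ v, v ∈ T ↔ partColour K T W v = 0 := by
    intro v; unfold partColour; split_ifs <;> simp_all
  have h1 : ∀ v, v ∈ K ↔ partColour K T W v ≤ 1 := by
    intro v
    have := @hT v
    unfold partColour; split_ifs <;> simp_all
  have h2 : ∀ v, v ∈ W ↔ partColour K T W v = 2 := by
    intro v
    have := @hT v
    have := hKW' v
    unfold partColour; split_ifs <;> simp_all
  simp only [layered, notMem_empty, and_false, false_and, false_or, h0, h1, h2]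

theorem IsColex.nonempty_iso {V V' : Type*} [Fintype V] [Fintype V'] {G : SimpleGraph V}
    {G' : SimpleGraph V'} {k t : ℕ} (hcard : Fintype.card V = Fintype.card V')
    (h : IsColex G k t) (h' : IsColex G' k t) : Nonempty (G ≃g G') := by
  obtain ⟨K, T, W, hT, hKW, hk, ht, hW, rfl⟩ := h
  obtain ⟨K', T', W', hT', hKW', hk', ht', hW', rfl⟩ := h'
  obtain ⟨e, he⟩ := exists_equiv_of_card_fiber (partColour K T W) (partColour K' T' W') fun c => by
    have h1 := card_partColour hT hKW c
    have h2 := card_partColour hT' hKW' c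
    rw [hk, ht, hW, hcard] at h1
    rw [hk', ht', hW'] at h2
    convert h1.trans h2.symm
  exact ⟨⟨e, by
    intro a b
    rw [layered_adj_iff hT hKW, layered_adj_iff hT' hKW', he, he, e.injective.ne_iff]⟩⟩

theorem extremalGraph_isColex {n m : ℕ} (h : tStar m ≤ kStar m) :
    IsColex (extremalGraph n m) (kStar m) (tStar m) := by
  let f : Fin (kStar m) → (Fin (kStar m) ⊕ Fin (sigma (tStar m))) ⊕
    Fin (n - kStar m - sigma (tStar m)) := fun i => Sum.inl (Sum.inl i)
  let g : Fin (sigma (tStar m)) → (Fin (kStar m) ⊕ Fin (sigma (tStar m))) ⊕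
    Fin (n - kStar m - sigma (tStar m)) := fun i => Sum.inl (Sum.inr i)
  have hf : f.Injective := Sum.inl_injective.comp Sum.inl_injective
  have hg : g.Injective := Sum.inl_injective.comp Sum.inr_injective
  refine ⟨univ.image f, (univ.filter fun i : Fin (kStar m) => (i : ℕ) < tStar m).image f,
    univ.image g, image_subset_image (subset_univ _), ?_, ?_, ?_, ?_, ?_⟩
  · rw [Finset.disjoint_left]
    intro a ha hb
    obtain ⟨i, -, rfl⟩ := mem_image.1 ha
    obtain ⟨j, -, hj⟩ := mem_image.1 hb
    simp [f, g] at hj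
  · rw [card_image_of_injective _ hf, card_univ, Fintype.card_fin]
  · rw [card_image_of_injective _ hf, Fin.card_filter_val_lt, min_eq_right h]
  · rw [card_image_of_injective _ hg, card_univ, Fintype.card_fin]
  · ext a b
    rcases a with (a | a) | a <;> rcases b with (b | b) | b <;>
      simp [extremalGraph, quasiComplete, layered, f, g]

end Isomorphism

/-! ### Arithmetic of `kStar` and `tStar` -/

theorem kStar_spec (m : ℕ) : tStar m < kStar m ∧
    2 * m + kStar m = kStar m * kStar m + 2 * tStar m := by
  obtain ⟨h1, h2⟩ := kStar_isGreatest m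
  have h1 : (kStar m).choose 2 ≤ m := h1
  have h3 : m < (kStar m + 1).choose 2 := by
    by_contra! h
    have := h2 (show kStar m + 1 ∈ {k : ℕ | k.choose 2 ≤ m} from h)
    omega
  have h4 : (kStar m + 1).choose 2 = kStar m + (kStar m).choose 2 := by
    rw [Nat.choose_succ_succ' (kStar m) 1, Nat.choose_one_right]
  have h5 : (kStar m).choose 2 * 2 + kStar m = kStar m * kStar m := by
    rw [Nat.choose_two_right, Nat.div_mul_cancel (Nat.even_mul_pred_self _).two_dvd]
    rcases kStar m with _ | k
    · rfl
    · simp only [Nat.add_sub_cancel]; ring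
  unfold tStar
  omega

/-- The only tight case is `kStar m = n`, where `m ≤ C(n,2)` forces `tStar m = 0`. -/
theorem kStar_add_sigma_le {n m : ℕ} (h : m ≤ n.choose 2) (hm : 1 ≤ m) :
    kStar m + sigma (tStar m) ≤ n := by
  obtain ⟨h1, h2⟩ := kStar_spec m
  have h5 : n.choose 2 * 2 + n = n * n := by
    rw [Nat.choose_two_right, Nat.div_mul_cancel (Nat.even_mul_pred_self _).two_dvd]
    rcases n with _ | k
    · rfl
    · simp only [Nat.add_sub_cancel]; ring
  have hs : sigma (tStar m) ≤ 1 ∧ (tStar m = 0 → sigma (tStar m) = 0) := by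
    unfold sigma; split_ifs <;> simp_all
  have hk : kStar m ≤ n := by
    by_contra! hlt
    obtain ⟨l, hl⟩ := Nat.exists_eq_add_of_lt hlt
    rw [hl] at h2
    have : n = 0 := by nlinarith
    subst this
    simp at h
    omega
  rcases hk.eq_or_lt with hk | hk
  · have : tStar m = 0 := by
      rw [hk] at h2
      omega
    have := hs.2 this
    omega
  · omega

/-! ### Translation to entropy and base-2 logarithms -/

section Bridge

open Finset

variable {V : Type*} [Fintype V] (G : SimpleGraph V) [DecidableRel G.Adj]

theorem degree_eq_deg (v : V) : G.degree v = deg G v := by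
  classical
  refine (deg_eq_card fun u => ?_).symm
  rw [mem_neighborFinset]

theorem degSum_eq_two_mul [DecidableEq V] : degSum G = 2 * #G.edgeFinset := by
  rw [← sum_degrees_eq_twice_card_edges, degSum]
  exact sum_congr rfl fun v _ => (degree_eq_deg G v).symm

theorem degreeLogSum_eq : degreeLogSum G = xlogSum G / Real.log 2 := by
  rw [degreeLogSum, xlogSum, sum_div]
  refine sum_congr rfl fun v _ => ?_
  rw [degree_eq_deg, xlog, Real.logb, mul_div_assoc]

theorem degreeEntropy_eq {m : ℕ} (hm : 1 ≤ m) (h : degSum G = 2 * m) :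
    degreeEntropy G = Real.logb 2 (2 * m) - xlogSum G / Real.log 2 / (2 * m) := by
  have hm0 : (0 : ℝ) < 2 * m := by positivity
  have hs : ∑ u, (G.degree u : ℝ) = 2 * m := by
    simp only [degree_eq_deg]
    rw [← Nat.cast_sum]
    exact_mod_cast h
  have hl : Real.log 2 ≠ 0 := (Real.log_pos one_lt_two).ne'
  have hpt : ∀ v, (G.degree v : ℝ) / (2 * m) * Real.logb 2 ((G.degree v : ℝ) / (2 * m)) =
      xlog (deg G v) / Real.log 2 / (2 * m) - G.degree v / (2 * m) * Real.logb 2 (2 * m) := by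
    intro v
    rw [degree_eq_deg]
    rcases Nat.eq_zero_or_pos (deg G v) with h0 | h0
    · simp [h0]
    · have h0' : (0 : ℝ) < deg G v := by exact_mod_cast h0
      rw [Real.logb, Real.logb, Real.log_div h0'.ne' hm0.ne', xlog]
      field_simp
  rw [degreeEntropy, hs, sum_congr rfl fun v _ => hpt v, sum_sub_distrib, ← sum_mul, ← sum_div, ← sum_div,
    ← sum_div, hs, div_self hm0.ne', ← xlogSum]
  ring

theorem colexValue_div_log (k t : ℕ) : colexValue k t / Real.log 2 =
    (t : ℝ) * k * Real.logb 2 k + ((k : ℝ) - t) * ((k : ℝ) - 1) * Real.logb 2 ((k : ℝ) - 1) +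
      t * Real.logb 2 t := by
  unfold colexValue xlog Real.logb
  ring

end Bridge

end DegreeEntropy

open DegreeEntropy in
theorem theorem1p1 {V : Type*} [Fintype V] [DecidableEq V] (G : SimpleGraph V)
    [DecidableRel G.Adj] (n m : ℕ) (hn : 2 ≤ n) (hm : 1 ≤ m) (hmn : m ≤ n.choose 2)
    (hV : Fintype.card V = n) (hE : G.edgeFinset.card = m) :
    (DegreeEntropy.degreeEntropy G ≥
      Real.logb 2 (2 * (m : ℝ)) -
        ((DegreeEntropy.tStar m : ℝ) * (DegreeEntropy.kStar m : ℝ) *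
            Real.logb 2 (DegreeEntropy.kStar m : ℝ) +
          ((DegreeEntropy.kStar m : ℝ) - (DegreeEntropy.tStar m : ℝ)) *
            ((DegreeEntropy.kStar m : ℝ) - 1) *
            Real.logb 2 ((DegreeEntropy.kStar m : ℝ) - 1) +
          (DegreeEntropy.tStar m : ℝ) * Real.logb 2 (DegreeEntropy.tStar m : ℝ)) /
        (2 * (m : ℝ))) ∧
    (DegreeEntropy.degreeEntropy G =
      Real.logb 2 (2 * (m : ℝ)) -
        ((DegreeEntropy.tStar m : ℝ) * (DegreeEntropy.kStar m : ℝ) *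
            Real.logb 2 (DegreeEntropy.kStar m : ℝ) +
          ((DegreeEntropy.kStar m : ℝ) - (DegreeEntropy.tStar m : ℝ)) *
            ((DegreeEntropy.kStar m : ℝ) - 1) *
            Real.logb 2 ((DegreeEntropy.kStar m : ℝ) - 1) +
          (DegreeEntropy.tStar m : ℝ) * Real.logb 2 (DegreeEntropy.tStar m : ℝ)) /
        (2 * (m : ℝ)) ↔
      Nonempty (G ≃g DegreeEntropy.extremalGraph n m)) ∧
    ((∀ (H : SimpleGraph V) [DecidableRel H.Adj], H.edgeFinset.card = m →
        DegreeEntropy.degreeLogSum H ≤ DegreeEntropy.degreeLogSum G) ↔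
      Nonempty (G ≃g DegreeEntropy.extremalGraph n m)) := by
  obtain ⟨htk, hspec⟩ := kStar_spec m
  have hle := kStar_add_sigma_le hmn hm
  have hk : 2 ≤ kStar m := (kStar_isGreatest m).2 (show Nat.choose 2 2 ≤ m by simpa using hm)
  have hdeg : degSum G = 2 * m := by rw [degSum_eq_two_mul, hE]
  have hdeg' : degSum G + kStar m = kStar m * kStar m + 2 * tStar m := by rw [hdeg, hspec]
  have hext := extremalGraph_isColex (n := n) htk.le
  have hiso : Nonempty (G ≃g extremalGraph n m) ↔ IsColex G (kStar m) (tStar m) := by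
    constructor
    · rintro ⟨e⟩
      -- The value of the sum characterizes the extremal graphs and is invariant under isomorphism,
      -- so the parts `K`, `T`, `W` need not be transported along `e`.
      rw [← xlogSum_eq_colexValue_iff htk hk hdeg', ← xlogSum_iso e, hext.xlogSum (by omega)]
    · intro h
      refine h.nonempty_iso ?_ hext
      simp only [Fintype.card_sum, Fintype.card_fin]
      omega
  have hl : 0 < Real.log 2 := Real.log_pos one_lt_two
  have hm0 : (0 : ℝ) < 2 * m := by positivity
  rw [degreeEntropy_eq G hm hdeg, ← colexValue_div_log, hiso]
  refine ⟨?_, ?_, ?_⟩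
  · have := xlogSum_le_colexValue _ _ _ G htk hdeg' rfl
    rw [ge_iff_le]
    gcongr
  · rw [← xlogSum_eq_colexValue_iff htk hk hdeg', sub_right_inj, div_left_inj' hm0.ne',
      div_left_inj' hl.ne']
  · rw [← isXlogMax_iff_isColex htk hk hdeg']
    constructor
    · intro h H hH
      classical
      have h1 := h H (by have := degSum_eq_two_mul H; omega)
      rwa [degreeLogSum_eq, degreeLogSum_eq, div_le_div_iff_of_pos_right hl] at h1
    · intro h H _ hH
      have h1 := h H (by rw [hdeg, degSum_eq_two_mul, hH])
      rw [degreeLogSum_eq, degreeLogSum_eq]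
      gcongr
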